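/- **Setting.** For each sample size $n$ let $p=p_n$ and $s=s_n\ge 1$ be integers, let $\beta_0,\gamma_0\in\mathbb R^{p}$ and $\tau_0\in\mathbb R\cup\{-\infty\}$ (all may depend on $n$), and put $\xi_n=\|\beta_0-\gamma_0\|_2$ and $S=\{j:\beta_{0j}\neq0\}\cup\{j:\gamma_{0j}\neq 0\}$. Observe random variables $x_i\in\mathbb R^p$ and $w_i\in\mathbb R$, with errors $\varepsilon_i\in\mathbb R$, $i=1,\dots,n$. A variable $\eta$ is subgaussian with variance parameter $\sigma^2$ if $E e^{t\eta}\le e^{\sigma^2t^2/2}$ for all $t\in\mathbb R$; a vector is, if all its inner products with unit vectors are. * *Condition A(i),(ii).* $|S|\le s$; $s\log p/n\to0$; and $l_n$ is a sequence with $0<l_n\le 1/2$ and $s\log p/(nl_n^2)\to0$. * *Condition B.* Let $0<\kappa\le\phi<\infty$ and $C<\infty$ not depend on $n$. (i) The $x_i$ are i.i.d., centred, subgaussian with variance parameter $\sigma_x^2\le C$, and all eigenvalues of $\Sigma=E[x_ix_i^T]$ lie in $[\kappa,\phi]$. (ii) The $\varepsilon_i$ are i.i.d., centred, subgaussian with variance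 parameter $\sigma_\varepsilon^2\le C$. (iii) The $w_i$ are i.i.d. with an arbitrary distribution function $\Phi(a)=P(w_i\le a)$ (continuous or not), with $\Phi(-\infty)=0$. (iv) The samples $(x_i)_i$, $(w_i)_i$, $(\varepsilon_i)_i$ are mutually independent. Put $\Phi_{\min}(\tau)=\min\{\Phi(\tau),1-\Phi(\tau)\}$, $\Phi^*(\tau_0,\tau)=|\Phi(\tau)-\Phi(\tau_0)|$, $\mathcal T(\tau_0,u)=\{\tau\in\mathbb R\cup\{-\infty\}:\Phi^*(\tau_0,\tau)\le u\}$, $$\mathbb A=\{\delta\in\mathbb R^p:\|\delta_{S^c}\|_1\le3\|\delta_S\|_1\},\qquad \mathbb A_2=\{\delta\in\mathbb R^p:\|\delta_{S^c}\|_1\le3\|\delta_S\|_1+3\|\beta_0-\gamma_0\|_1\},$$ and let $n_w(\tau_0,\tau)$ be the random set of indices $i$ with $\tau_0<w_i\le\tau$ if $\tau\ge\tau_0$, and with $\tau<w_i\le\tau_0$ if $\tau\le\tau_0$. **Lemma (Restricted Eigenvalue Conditions).** There are a universal constant $c_u>0$, constants $c_3,c_4,c_5>0$ depending only on $\kappa,\phi,C$,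 and, for every $c>0$, constants $c_1,c_2>0$ depending only on $\kappa,\phi,C,c$, with the following property. Suppose Conditions A(i), A(ii) and B hold, let $u_n,v_n\ge0$ be sequences with $v_n\ge c\log p/n$, and let $\tau=\tau_n\in\mathbb R$ be such that $\Phi_{\min}(\tau)>0$ for all large $n$ and $\Phi_{\min}^{-1}(\tau)\,s\log p/n=o(1)$. Then, for all sufficiently large $n$, with probability at least $1-c_1\exp(-c_2\log p)$ all of the following hold simultaneously: 1. for all $\delta\in\mathbb A$: $\ \frac1n\sum_{i:\,w_i\le\tau}\delta^Tx_ix_i^T\delta\ge c_u\kappa\,\Phi(\tau)\|\delta\|_2^2$; 2. for all $\delta\in\mathbb A$: $\ \frac1n\sum_{i:\,w_i>\tau}\delta^Tx_ix_i^T\delta\ge c_u\kappa\,(1-\Phi(\tau))\|\delta\|_2^2$; 3. for all $t\in\mathcal T(\tau_0,u_n)$ and all $\delta\in\mathbb A$: $\ \frac1n\sum_{i\in n_w(\tau_0,t)}\delta^Tx_ix_i^T\delta\le c_3\|\delta\|_2^2\max\{\frac{s\log p}{n},u_n\}$; 4. for all $t\in\mathbb R$ with $\Phi^*(\tau_0,t)\ge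 v_n$ and all $\delta\in\mathbb A_2$: $\ \frac1n\sum_{i\in n_w(\tau_0,t)}\delta^Tx_ix_i^T\delta\ge c_4v_n\|\delta\|_2^2-c_5\frac{s\log p}{n}\big(\|\delta\|_2^2+\xi_n^2\big)$. -/

import Mathlib

open MeasureTheory ProbabilityTheory Filter Topology
open scoped NNReal

namespace ChangePoint

/-- The distribution function `Φ(τ) = P(w ≤ τ)` of a law `ν` on `ℝ`, for `τ ∈ ℝ ∪ {-∞}`
(`⊥` is `-∞`, so that `Φ(-∞) = 0`). -/
noncomputable def Phi (ν : Measure ℝ) (τ : WithBot ℝ) : ℝ :=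
  ν.real {w : ℝ | (w : WithBot ℝ) ≤ τ}

/-- `Φ_min(τ) = min (Φ(τ)) (1 - Φ(τ))`. -/
noncomputable def PhiMin (ν : Measure ℝ) (τ : WithBot ℝ) : ℝ :=
  min (Phi ν τ) (1 - Phi ν τ)

/-- `Φ*(τ₀, τ) = |Φ(τ) - Φ(τ₀)|`. -/
noncomputable def PhiStar (ν : Measure ℝ) (τ₀ τ : WithBot ℝ) : ℝ :=
  |Phi ν τ - Phi ν τ₀|

/-- The `u`-neighbourhood `𝒯(τ₀, u)` of `τ₀`, inside `ℝ ∪ {-∞}`. -/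
def Nbhd (ν : Measure ℝ) (τ₀ : WithBot ℝ) (u : ℝ) : Set (WithBot ℝ) :=
  {τ | PhiStar ν τ₀ τ ≤ u}

/-- `S = {j : β₀ⱼ ≠ 0} ∪ {j : γ₀ⱼ ≠ 0}`. -/
noncomputable def suppSet {p : ℕ} (β₀ γ₀ : EuclideanSpace ℝ (Fin p)) : Finset (Fin p) :=
  Finset.univ.filter fun j => β₀ j ≠ 0 ∨ γ₀ j ≠ 0

/-- `‖δ_T‖₁`, the `ℓ₁` norm of the subvector of `δ` with indices in `T`. -/
noncomputable def l1On {p : ℕ} (T : Finset (Fin p)) (δ : EuclideanSpace ℝ (Fin p)) : ℝ :=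
  ∑ j ∈ T, |δ j|

/-- The cone `𝔸 = {δ : ‖δ_{Sᶜ}‖₁ ≤ 3 ‖δ_S‖₁}`. -/
def coneA {p : ℕ} (S : Finset (Fin p)) : Set (EuclideanSpace ℝ (Fin p)) :=
  {δ | l1On Sᶜ δ ≤ 3 * l1On S δ}

/-- The enlarged cone `𝔸₂ = {δ : ‖δ_{Sᶜ}‖₁ ≤ 3 ‖δ_S‖₁ + 3 ‖β₀ - γ₀‖₁}`, where `S` is the
joint support of `β₀` and `γ₀`. -/
def coneA₂ {p : ℕ} (β₀ γ₀ : EuclideanSpace ℝ (Fin p)) : Set (EuclideanSpace ℝ (Fin p)) :=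
  {δ | l1On (suppSet β₀ γ₀)ᶜ δ ≤
    3 * l1On (suppSet β₀ γ₀) δ + 3 * l1On Finset.univ (β₀ - γ₀)}

/-- The indices `i` with `wᵢ ≤ τ`. -/
noncomputable def idxLe {n : ℕ} (w : Fin n → ℝ) (τ : ℝ) : Finset (Fin n) :=
  Finset.univ.filter fun i => w i ≤ τ

/-- The indices `i` with `wᵢ > τ`. -/
noncomputable def idxGt {n : ℕ} (w : Fin n → ℝ) (τ : ℝ) : Finset (Fin n) :=
  Finset.univ.filter fun i => τ < w i

open Classical in
/-- The index set `n_w(τ₀, τ)` of the observations between `τ₀` and `τ`: those with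
`τ₀ < wᵢ ≤ τ` if `τ₀ ≤ τ`, and those with `τ < wᵢ ≤ τ₀` if `τ ≤ τ₀`. -/
noncomputable def idxBetween {n : ℕ} (w : Fin n → ℝ) (τ₀ τ : WithBot ℝ) : Finset (Fin n) :=
  Finset.univ.filter fun i =>
    (τ₀ < (w i : WithBot ℝ) ∧ (w i : WithBot ℝ) ≤ τ) ∨
      (τ < (w i : WithBot ℝ) ∧ (w i : WithBot ℝ) ≤ τ₀)

/-- `(1/n) ∑_{i ∈ I} δᵀ xᵢ xᵢᵀ δ`; note that `δᵀ xᵢ xᵢᵀ δ = ⟨xᵢ, δ⟩²`. -/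
noncomputable def gramForm {n p : ℕ} (x : Fin n → EuclideanSpace ℝ (Fin p))
    (I : Finset (Fin n)) (δ : EuclideanSpace ℝ (Fin p)) : ℝ :=
  (1 / (n : ℝ)) * ∑ i ∈ I, (inner ℝ (x i) δ) ^ 2

/-- The matrix `E[x xᵀ]` of a random vector `x`. -/
noncomputable def secondMoment {Ω : Type*} [MeasurableSpace Ω] {p : ℕ} (P : Measure Ω)
    (x : Ω → EuclideanSpace ℝ (Fin p)) : Matrix (Fin p) (Fin p) ℝ :=
  Matrix.of fun j k => ∫ ω, x ω j * x ω k ∂P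

/-- Parts (i) and (ii) of the assumptions on the model parameters, for sequences of dimensions
`p n`, sparsity levels `s n`, regression parameters `β₀ n`, `γ₀ n`, and `l n`. -/
structure ConditionA (p s : ℕ → ℕ) (β₀ γ₀ : (n : ℕ) → EuclideanSpace ℝ (Fin (p n)))
    (l : ℕ → ℝ) : Prop where
  one_le_s : ∀ n, 1 ≤ s n
  card_le : ∀ n, (suppSet (β₀ n) (γ₀ n)).card ≤ s n
  rate : Tendsto (fun n : ℕ => (s n : ℝ) * Real.log (p n) / n) atTop (𝓝 0)
  l_pos : ∀ n, 0 < l n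
  l_le : ∀ n, l n ≤ 1 / 2
  rate_l : Tendsto (fun n : ℕ => (s n : ℝ) * Real.log (p n) / (n * l n ^ 2)) atTop (𝓝 0)

/-- The assumptions on the model distributions for a sample of size `n`: design vectors
`X i`, change inducing variables `W i` with law `ν`, and errors `ε i`. -/
structure ConditionB {n p : ℕ} {Ω : Type*} [MeasurableSpace Ω] (P : Measure Ω)
    (X : Fin n → Ω → EuclideanSpace ℝ (Fin p)) (W ε : Fin n → Ω → ℝ) (ν : Measure ℝ)
    (κ φ C : ℝ) : Prop where
  /- (i) the design vectors are i.i.d., centred, subgaussian, with bounded eigenvalues -/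
  measurable_X : ∀ i, Measurable (X i)
  iIndep_X : iIndepFun X P
  ident_X : ∀ i j, IdentDistrib (X i) (X j) P P
  mean_X : ∀ i k, ∫ ω, X i ω k ∂P = 0
  subgaussian_X : ∃ σsq : ℝ≥0, (σsq : ℝ) ≤ C ∧ ∀ i, ∀ v : EuclideanSpace ℝ (Fin p), ‖v‖ = 1 →
    HasSubgaussianMGF (fun ω => inner ℝ (X i ω) v) σsq P
  eigenvalues_X : ∀ i, spectrum ℝ (secondMoment P (X i)) ⊆ Set.Icc κ φ
  /- (ii) the errors are i.i.d., centred and subgaussian -/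
  measurable_ε : ∀ i, Measurable (ε i)
  iIndep_ε : iIndepFun ε P
  ident_ε : ∀ i j, IdentDistrib (ε i) (ε j) P P
  mean_ε : ∀ i, ∫ ω, ε i ω ∂P = 0
  subgaussian_ε : ∃ σsq : ℝ≥0, (σsq : ℝ) ≤ C ∧ ∀ i, HasSubgaussianMGF (ε i) σsq P
  /- (iii) the change inducing variables are i.i.d. with an arbitrary law -/
  measurable_W : ∀ i, Measurable (W i)
  iIndep_W : iIndepFun W P
  law_W : ∀ i, HasLaw (W i) ν P
  /- (iv) the three samples are independent of each other -/
  indep_X_W : IndepFun (fun ω i => X i ω) (fun ω i => W i ω) P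
  indep_XW_ε : IndepFun (fun ω => ((fun i => X i ω), (fun i => W i ω))) (fun ω i => ε i ω) P

end ChangePoint

namespace ChangePoint

/-! ### Averaging over sparse sign combinations (Maurey's empirical method) -/

/-! Fix a Borel set `A` with mass q = `ν.real A`, and let Q(δ) be the Gram form restricted to the
observations with wᵢ ∈ A. Everything follows from two bounds, each holding with high probability for
all δ ∈ ℝᵖ at once, with L = log p / n: an upper bound Q(δ) ≤ U (q'‖δ‖₂² + 2L‖δ‖₁²) for any q' ≥
max(q, L), and a lower bound Q(δ) ≥ (κ/4) q ‖δ‖₂² − D L ‖δ‖₁² (`exists_event_gramForm_le`,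
`exists_event_le_gramForm`). On a cone, ‖δ‖₁² is at most a multiple of s‖δ‖₂², or of s(‖δ‖₂² + ξ²)
on the enlarged one, so the ℓ₁ term becomes an s log p / n term.

For one direction, Q is a mean of independent terms 1_A(wᵢ)⟨xᵢ, δ⟩². Independence of xᵢ and wᵢ makes
the moment generating function of a term equal to 1 + q(E exp(t⟨xᵢ, δ⟩²) − 1), so Chernoff bounds
decay at rate nq, not n. The positive side uses a bounded exponential moment of the square, the
negative side E⟨x, δ⟩² ≥ κ and a second order expansion.

Uniformity in δ comes from Maurey's method. A vector with ‖δ‖₁ = 1 is the mean of a random signed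
basis vector; for the sum z of k independent copies, E Q(z) and E‖z‖² are k(k−1)Q(δ) and k(k−1)‖δ‖²
plus terms of order k. A bound for the at most (2p)ᵏ values of z thus passes to δ at a cost of order
‖δ‖₁²/k. Taking k of order nq / log p balances the union bound against the tail.

Uniformity in the threshold is deterministic. The sets between τ₀ and t, over t close to τ₀, lie in
one set of mass at most 2u; those over t far from τ₀ on a given side all contain one set of mass at
least v. Monotonicity of Q in the index set then reduces all t to a single `A`, with no continuity
of the law of w. -/

theorem sum_prod_weights {α : Type*} [Fintype α] (w : α → ℝ) (hw : ∑ a, w a = 1) (k : ℕ) :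
    ∑ f : Fin k → α, ∏ l, w (f l) = 1 := by
  induction k with
  | zero => simp
  | succ k ih =>
    rw [← (Fin.consEquiv (fun _ : Fin (k + 1) => α)).sum_comp, Fintype.sum_prod_type]
    simp [Fin.consEquiv_apply, Fin.prod_univ_succ, ← Finset.mul_sum, ih, hw]

theorem sum_prod_weights_mul_sum {α : Type*} [Fintype α] (w y : α → ℝ) (hw : ∑ a, w a = 1)
    (k : ℕ) :
    ∑ f : Fin k → α, (∏ l, w (f l)) * ∑ l, y (f l) = k * ∑ a, w a * y a := by
  induction k with
  | zero => simp
  | succ k ih =>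
    rw [← (Fin.consEquiv (fun _ : Fin (k + 1) => α)).sum_comp, Fintype.sum_prod_type]
    simp only [Fin.consEquiv_apply, Fin.prod_univ_succ, Fin.sum_univ_succ, Fin.cons_zero,
      Fin.cons_succ]
    have h : ∀ a : α, ∑ f : Fin k → α, w a * (∏ l, w (f l)) * (y a + ∑ l, y (f l)) =
        w a * y a + w a * (k * ∑ b, w b * y b) := by
      intro a
      rw [← ih, ← mul_one (w a * y a), ← sum_prod_weights w hw k, Finset.mul_sum, Finset.mul_sum,
        ← Finset.sum_add_distrib]
      exact Finset.sum_congr rfl fun f _ => by ring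
    simp only [h, Finset.sum_add_distrib]
    rw [← Finset.sum_mul, hw]
    push_cast
    ring

/-- For nonnegative weights this is the second moment of a sum of k independent draws from `w`: the
k(k−1) off-diagonal pairs factor and the k diagonal ones do not. Being a polynomial identity, it
needs no sign condition. -/
theorem sum_prod_weights_mul_sq_sum {α : Type*} [Fintype α] (w y : α → ℝ) (hw : ∑ a, w a = 1)
    (k : ℕ) :
    ∑ f : Fin k → α, (∏ l, w (f l)) * (∑ l, y (f l)) ^ 2 =
      k * (k - 1) * (∑ a, w a * y a) ^ 2 + k * ∑ a, w a * y a ^ 2 := by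
  induction k with
  | zero => simp
  | succ k ih =>
    rw [← (Fin.consEquiv (fun _ : Fin (k + 1) => α)).sum_comp, Fintype.sum_prod_type]
    simp only [Fin.consEquiv_apply, Fin.prod_univ_succ, Fin.sum_univ_succ, Fin.cons_zero,
      Fin.cons_succ]
    have h : ∀ a : α, ∑ f : Fin k → α, w a * (∏ l, w (f l)) * (y a + ∑ l, y (f l)) ^ 2 =
        w a * y a ^ 2 + 2 * (w a * y a) * (k * ∑ b, w b * y b) +
          w a * (k * (k - 1) * (∑ b, w b * y b) ^ 2 + k * ∑ b, w b * y b ^ 2) := by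
      intro a
      rw [← ih, ← sum_prod_weights_mul_sum w y hw k, ← mul_one (w a * y a ^ 2),
        ← sum_prod_weights w hw k, Finset.mul_sum, Finset.mul_sum, Finset.mul_sum,
        ← Finset.sum_add_distrib, ← Finset.sum_add_distrib]
      exact Finset.sum_congr rfl fun f _ => by ring
    simp only [h, Finset.sum_add_distrib]
    rw [← Finset.sum_mul, ← Finset.sum_mul, ← Finset.mul_sum, hw]
    push_cast
    ring

/-- The signed standard basis vectors of `ℝᵖ`. -/
noncomputable def signedBasis {p : ℕ} (a : Fin p × Bool) : EuclideanSpace ℝ (Fin p) :=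
  EuclideanSpace.single a.1 (if a.2 then 1 else -1)

/-- Weights writing `δ` as a nonnegative combination of signed basis vectors. -/
noncomputable def signedWeight {p : ℕ} (δ : EuclideanSpace ℝ (Fin p)) (a : Fin p × Bool) : ℝ :=
  if a.2 then max (δ a.1) 0 else max (-δ a.1) 0

theorem signedWeight_nonneg {p : ℕ} (δ : EuclideanSpace ℝ (Fin p)) (a : Fin p × Bool) :
    0 ≤ signedWeight δ a := by
  unfold signedWeight; split_ifs <;> exact le_max_right _ _

theorem sum_signedWeight {p : ℕ} (δ : EuclideanSpace ℝ (Fin p)) :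
    ∑ a, signedWeight δ a = l1On Finset.univ δ := by
  rw [Fintype.sum_prod_type]
  refine Finset.sum_congr rfl fun j _ => ?_
  simp only [signedWeight, Fintype.sum_bool, if_true, Bool.false_eq_true, if_false]
  rcases le_total 0 (δ j) with h | h
  · rw [max_eq_left h, max_eq_right (by linarith), abs_of_nonneg h, add_zero]
  · rw [max_eq_right h, max_eq_left (by linarith), abs_of_nonpos h, zero_add]

theorem norm_signedBasis {p : ℕ} (a : Fin p × Bool) : ‖signedBasis a‖ = 1 := by
  unfold signedBasis
  rw [PiLp.norm_single]
  split_ifs <;> simp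

theorem sum_signedWeight_smul {p : ℕ} (δ : EuclideanSpace ℝ (Fin p)) :
    ∑ a, signedWeight δ a • signedBasis a = δ := by
  rw [Fintype.sum_prod_type]
  ext i
  simp only [WithLp.ofLp_sum, Finset.sum_apply]
  rw [Finset.sum_eq_single i]
  · simp only [signedWeight, signedBasis, Fintype.sum_bool, if_true, Bool.false_eq_true, if_false]
    rcases le_total 0 (δ i) with h | h
    · simp [max_eq_left h, max_eq_right (neg_nonpos.2 h)]
    · simp [max_eq_right h, max_eq_left (neg_nonneg.2 h)]
  · intro j _ hj
    simp [signedWeight, signedBasis, hj.symm]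
  · simp

theorem sum_signedWeight_mul_inner {p : ℕ} (δ x : EuclideanSpace ℝ (Fin p)) :
    ∑ a, signedWeight δ a * inner ℝ x (signedBasis a) = inner ℝ x δ := by
  conv_rhs => rw [← sum_signedWeight_smul δ]
  simp [inner_sum, real_inner_smul_right]

theorem sum_prod_mul_gramForm {n p : ℕ} (x : Fin n → EuclideanSpace ℝ (Fin p)) (I : Finset (Fin n))
    (δ : EuclideanSpace ℝ (Fin p)) (hδ : l1On Finset.univ δ = 1) (k : ℕ) :
    ∑ f : Fin k → Fin p × Bool, (∏ l, signedWeight δ (f l)) *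
        gramForm x I (∑ l, signedBasis (f l)) =
      k * (k - 1) * gramForm x I δ + k * ∑ a, signedWeight δ a * gramForm x I (signedBasis a) := by
  have h := fun i => sum_prod_weights_mul_sq_sum (signedWeight δ)
    (fun a => inner ℝ (x i) (signedBasis a)) ((sum_signedWeight δ).trans hδ) k
  simp only [sum_signedWeight_mul_inner] at h
  simp only [gramForm, inner_sum, Finset.mul_sum]
  rw [Finset.sum_comm, Finset.sum_comm (s := (Finset.univ : Finset (Fin p × Bool))),
    ← Finset.sum_add_distrib]
  refine Finset.sum_congr rfl fun i _ => ?_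
  have h' := congrArg (fun r => (1 / (n : ℝ)) * r) (h i)
  simp only [mul_add, Finset.mul_sum] at h'
  calc _ = _ := Finset.sum_congr rfl fun f _ => by ring
    _ = _ := h'
    _ = _ := by
      congr 1
      · ring
      · exact Finset.sum_congr rfl fun a _ => by ring

theorem sum_prod_mul_norm_sq {p : ℕ}
    (δ : EuclideanSpace ℝ (Fin p)) (hδ : l1On Finset.univ δ = 1) (k : ℕ) :
    ∑ f : Fin k → Fin p × Bool, (∏ l, signedWeight δ (f l)) *
        ‖∑ l, signedBasis (f l)‖ ^ 2 = k * (k - 1) * ‖δ‖ ^ 2 + k := by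
  have key : ∀ v : EuclideanSpace ℝ (Fin p), ‖v‖ ^ 2 = ∑ j, (v j) ^ 2 := fun v => by
    rw [EuclideanSpace.norm_sq_eq]; simp
  have h := fun j => sum_prod_weights_mul_sq_sum (signedWeight δ)
    (fun a => (signedBasis a) j) ((sum_signedWeight δ).trans hδ) k
  have h1 : ∀ j, ∑ a, signedWeight δ a * (signedBasis a) j = δ j := fun j => by
    conv_rhs => rw [← sum_signedWeight_smul δ]
    simp [WithLp.ofLp_sum]
  have h2 : ∑ j, ∑ a, signedWeight δ a * (signedBasis a) j ^ 2 = 1 := by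
    rw [Finset.sum_comm]
    simp only [← Finset.mul_sum, ← key, norm_signedBasis]
    simpa using (sum_signedWeight δ).trans hδ
  simp only [h1] at h
  simp only [key, Finset.mul_sum]
  rw [Finset.sum_comm]
  have h3 : ∀ j, ∑ f : Fin k → Fin p × Bool, (∏ l, signedWeight δ (f l)) *
      ((∑ l, signedBasis (f l)) j) ^ 2 =
      k * (k - 1) * δ j ^ 2 + k * ∑ a, signedWeight δ a * (signedBasis a) j ^ 2 := fun j => by
    rw [← h j]
    exact Finset.sum_congr rfl fun f _ => by simp [WithLp.ofLp_sum]
  rw [Finset.sum_congr rfl fun j _ => h3 j, Finset.sum_add_distrib, ← Finset.mul_sum,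
    ← Finset.mul_sum, h2, Finset.mul_sum, mul_one]

/-! ### From sparse sign combinations to arbitrary directions -/

theorem gramForm_nonneg {n p : ℕ} (x : Fin n → EuclideanSpace ℝ (Fin p)) (I : Finset (Fin n))
    (δ : EuclideanSpace ℝ (Fin p)) : 0 ≤ gramForm x I δ :=
  mul_nonneg (by positivity) (Finset.sum_nonneg fun _ _ => sq_nonneg _)

theorem gramForm_mono {n p : ℕ} (x : Fin n → EuclideanSpace ℝ (Fin p)) {I J : Finset (Fin n)}
    (h : I ⊆ J) (δ : EuclideanSpace ℝ (Fin p)) : gramForm x I δ ≤ gramForm x J δ :=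
  mul_le_mul_of_nonneg_left
    (Finset.sum_le_sum_of_subset_of_nonneg h fun _ _ _ => sq_nonneg _) (by positivity)

theorem gramForm_smul {n p : ℕ} (x : Fin n → EuclideanSpace ℝ (Fin p)) (I : Finset (Fin n))
    (r : ℝ) (δ : EuclideanSpace ℝ (Fin p)) : gramForm x I (r • δ) = r ^ 2 * gramForm x I δ := by
  simp only [gramForm, real_inner_smul_right, mul_pow, ← Finset.mul_sum]
  ring

theorem l1On_smul {p : ℕ} (T : Finset (Fin p)) (r : ℝ) (δ : EuclideanSpace ℝ (Fin p)) :
    l1On T (r • δ) = |r| * l1On T δ := by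
  simp [l1On, abs_mul, Finset.mul_sum]

theorem l1On_nonneg {p : ℕ} (T : Finset (Fin p)) (δ : EuclideanSpace ℝ (Fin p)) :
    0 ≤ l1On T δ := Finset.sum_nonneg fun _ _ => abs_nonneg _

theorem norm_le_l1On {p : ℕ} (δ : EuclideanSpace ℝ (Fin p)) : ‖δ‖ ≤ l1On Finset.univ δ := by
  conv_lhs => rw [← sum_signedWeight_smul δ]
  rw [← sum_signedWeight]
  refine (norm_sum_le _ _).trans (Finset.sum_le_sum fun a _ => ?_)
  rw [norm_smul, norm_signedBasis, mul_one, Real.norm_of_nonneg (signedWeight_nonneg δ a)]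

/-- To prove a quadratic inequality for all `δ` it is enough to treat `‖δ‖₁ = 1`. -/
theorem quadratic_le_of_l1_eq_one {n p : ℕ} (x : Fin n → EuclideanSpace ℝ (Fin p))
    (I : Finset (Fin n)) (a b c : ℝ)
    (h : ∀ δ, l1On Finset.univ δ = 1 → 0 ≤ a * gramForm x I δ + b * ‖δ‖ ^ 2 + c)
    (δ : EuclideanSpace ℝ (Fin p)) :
    0 ≤ a * gramForm x I δ + b * ‖δ‖ ^ 2 + c * l1On Finset.univ δ ^ 2 := by
  rcases (l1On_nonneg Finset.univ δ).eq_or_lt with h0 | h0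
  · have hδ : δ = 0 := by
      rw [← norm_le_zero_iff, h0]; exact norm_le_l1On δ
    subst hδ
    rw [← h0]
    simp [gramForm]
  · set r := l1On Finset.univ δ with hr
    have h1 := h (r⁻¹ • δ) (by
      rw [l1On_smul, abs_of_pos (inv_pos.2 h0), ← hr, inv_mul_cancel₀ h0.ne'])
    rw [gramForm_smul, norm_smul, mul_pow, Real.norm_of_nonneg (inv_pos.2 h0).le] at h1
    have h2 := mul_nonneg (sq_nonneg r) h1
    have h3 : r ^ 2 * r⁻¹ ^ 2 = 1 := by rw [← mul_pow, mul_inv_cancel₀ h0.ne', one_pow]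
    calc (0 : ℝ) ≤ _ := h2
      _ = a * (r ^ 2 * r⁻¹ ^ 2) * gramForm x I δ + b * (r ^ 2 * r⁻¹ ^ 2) * ‖δ‖ ^ 2 + c * r ^ 2 := by
        ring
      _ = _ := by rw [h3]; ring

/-- Averaging the hypothesis over the k draws and dividing by k gives θ((k−1)‖δ‖² + 1) ≤ (k−1)Q(δ) +
M when ‖δ‖₁ = 1. Since ‖δ‖₂ ≤ 1 and Q ≥ 0, both factors k−1 can be raised to k. -/
theorem gramForm_ge_of_sparse {n p : ℕ} (x : Fin n → EuclideanSpace ℝ (Fin p)) (I : Finset (Fin n))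
    {k : ℕ} (hk : 1 ≤ k) {θ M : ℝ} (hθ : 0 ≤ θ)
    (hz : ∀ f : Fin k → Fin p × Bool, θ * ‖∑ l, signedBasis (f l)‖ ^ 2 ≤
      gramForm x I (∑ l, signedBasis (f l)))
    (hM : ∀ a, gramForm x I (signedBasis a) ≤ M) (δ : EuclideanSpace ℝ (Fin p)) :
    θ * ‖δ‖ ^ 2 - M / k * l1On Finset.univ δ ^ 2 ≤ gramForm x I δ := by
  have hk' : (1 : ℝ) ≤ k := by exact_mod_cast hk
  have := quadratic_le_of_l1_eq_one x I 1 (-θ) (M / k) (fun δ hδ => ?_) δ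
  · linarith
  have h1 : ∑ f : Fin k → Fin p × Bool, (∏ l, signedWeight δ (f l)) *
        (θ * ‖∑ l, signedBasis (f l)‖ ^ 2) ≤ ∑ f : Fin k → Fin p × Bool,
        (∏ l, signedWeight δ (f l)) * gramForm x I (∑ l, signedBasis (f l)) :=
    Finset.sum_le_sum fun f _ => mul_le_mul_of_nonneg_left (hz f)
      (Finset.prod_nonneg fun l _ => signedWeight_nonneg δ _)
  rw [sum_prod_mul_gramForm x I δ hδ k] at h1
  have h2 : ∑ a, signedWeight δ a * gramForm x I (signedBasis a) ≤ M := by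
    calc _ ≤ ∑ a, signedWeight δ a * M := Finset.sum_le_sum fun a _ =>
          mul_le_mul_of_nonneg_left (hM a) (signedWeight_nonneg δ a)
      _ = M := by rw [← Finset.sum_mul, sum_signedWeight, hδ, one_mul]
  have h3 : ∑ f : Fin k → Fin p × Bool, (∏ l, signedWeight δ (f l)) *
        (θ * ‖∑ l, signedBasis (f l)‖ ^ 2) = θ * (k * (k - 1) * ‖δ‖ ^ 2 + k) := by
    rw [← sum_prod_mul_norm_sq δ hδ k, Finset.mul_sum]
    exact Finset.sum_congr rfl fun f _ => by ring
  rw [h3] at h1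
  have hn : ‖δ‖ ^ 2 ≤ 1 := by
    have := norm_le_l1On δ
    rw [hδ] at this
    exact pow_le_one₀ (norm_nonneg _) this
  have hQ := gramForm_nonneg x I δ
  have h4 : θ * ((k - 1) * ‖δ‖ ^ 2 + 1) ≤ (k - 1) * gramForm x I δ + M := by
    have : (k : ℝ) * (θ * ((k - 1) * ‖δ‖ ^ 2 + 1)) ≤ k * ((k - 1) * gramForm x I δ + M) := by
      have := mul_le_mul_of_nonneg_left h2 (by linarith : (0 : ℝ) ≤ k)
      nlinarith
    exact le_of_mul_le_mul_left this (by linarith)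
  have h5 : 0 ≤ k * gramForm x I δ - k * (θ * ‖δ‖ ^ 2) + M := by
    have := mul_nonneg hθ (sub_nonneg.2 hn)
    nlinarith
  have h6 := div_nonneg h5 (by linarith : (0 : ℝ) ≤ k)
  have h7 : (k * gramForm x I δ - k * (θ * ‖δ‖ ^ 2) + M) / k =
      1 * gramForm x I δ + -θ * ‖δ‖ ^ 2 + M / k := by
    field_simp; ring
  rwa [h7] at h6

/-- Here the diagonal term of the averaged Gram form is nonnegative and is dropped, so no bound on
the basis vectors is needed. Dividing by k−1 leaves θ/(k−1) ≤ 2θ/k, which is where k ≥ 2 enters. -/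
theorem gramForm_le_of_sparse {n p : ℕ} (x : Fin n → EuclideanSpace ℝ (Fin p)) (I : Finset (Fin n))
    {k : ℕ} (hk : 2 ≤ k) {θ : ℝ} (hθ : 0 ≤ θ)
    (hz : ∀ f : Fin k → Fin p × Bool, gramForm x I (∑ l, signedBasis (f l)) ≤
      θ * ‖∑ l, signedBasis (f l)‖ ^ 2) (δ : EuclideanSpace ℝ (Fin p)) :
    gramForm x I δ ≤ θ * ‖δ‖ ^ 2 + 2 * θ / k * l1On Finset.univ δ ^ 2 := by
  have hk' : (2 : ℝ) ≤ k := by exact_mod_cast hk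
  have := quadratic_le_of_l1_eq_one x I (-1) θ (2 * θ / k) (fun δ hδ => ?_) δ
  · linarith
  have h1 : ∑ f : Fin k → Fin p × Bool, (∏ l, signedWeight δ (f l)) *
        gramForm x I (∑ l, signedBasis (f l)) ≤ ∑ f : Fin k → Fin p × Bool,
        (∏ l, signedWeight δ (f l)) * (θ * ‖∑ l, signedBasis (f l)‖ ^ 2) :=
    Finset.sum_le_sum fun f _ => mul_le_mul_of_nonneg_left (hz f)
      (Finset.prod_nonneg fun l _ => signedWeight_nonneg δ _)
  rw [sum_prod_mul_gramForm x I δ hδ k] at h1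
  have h2 : 0 ≤ ∑ a, signedWeight δ a * gramForm x I (signedBasis a) :=
    Finset.sum_nonneg fun a _ => mul_nonneg (signedWeight_nonneg δ a) (gramForm_nonneg x I _)
  have h3 : ∑ f : Fin k → Fin p × Bool, (∏ l, signedWeight δ (f l)) *
        (θ * ‖∑ l, signedBasis (f l)‖ ^ 2) = θ * (k * (k - 1) * ‖δ‖ ^ 2 + k) := by
    rw [← sum_prod_mul_norm_sq δ hδ k, Finset.mul_sum]
    exact Finset.sum_congr rfl fun f _ => by ring
  rw [h3] at h1
  have h4 : (k - 1) * gramForm x I δ ≤ θ * ((k - 1) * ‖δ‖ ^ 2 + 1) := by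
    have : (k : ℝ) * ((k - 1) * gramForm x I δ) ≤ k * (θ * ((k - 1) * ‖δ‖ ^ 2 + 1)) := by
      have := mul_nonneg (by linarith : (0 : ℝ) ≤ k) h2
      nlinarith
    exact le_of_mul_le_mul_left this (by linarith)
  have h5 : 1 ≤ 2 / (k : ℝ) * (k - 1) := by
    rw [div_mul_eq_mul_div, le_div_iff₀ (by linarith)]; linarith
  have h6 : (k - 1) * gramForm x I δ ≤ (k - 1) * (θ * ‖δ‖ ^ 2 + 2 * θ / k) := by
    have := mul_le_mul_of_nonneg_left h5 hθ
    calc _ ≤ _ := h4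
      _ ≤ θ * ((k - 1) * ‖δ‖ ^ 2) + θ * (2 / (k : ℝ) * (k - 1)) := by linarith
      _ = _ := by ring
  have := le_of_mul_le_mul_left h6 (by linarith)
  linarith

/-! ### Cones -/

theorem l1On_sq_le {p : ℕ} (T : Finset (Fin p)) (δ : EuclideanSpace ℝ (Fin p)) :
    l1On T δ ^ 2 ≤ T.card * ‖δ‖ ^ 2 := by
  have h : ‖δ‖ ^ 2 = ∑ j, |δ j| ^ 2 := by rw [EuclideanSpace.norm_sq_eq]; simp
  rw [h]
  refine (sq_sum_le_card_mul_sum_sq).trans (mul_le_mul_of_nonneg_left ?_ (by positivity))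
  exact Finset.sum_le_sum_of_subset_of_nonneg (Finset.subset_univ T) fun _ _ _ => sq_nonneg _

theorem l1On_univ_eq {p : ℕ} (T : Finset (Fin p)) (δ : EuclideanSpace ℝ (Fin p)) :
    l1On Finset.univ δ = l1On T δ + l1On Tᶜ δ :=
  (Finset.sum_add_sum_compl T _).symm

theorem l1_sq_le_of_mem_coneA {p s : ℕ} {S : Finset (Fin p)} (hS : S.card ≤ s)
    {δ : EuclideanSpace ℝ (Fin p)} (hδ : δ ∈ coneA S) :
    l1On Finset.univ δ ^ 2 ≤ 16 * (s * ‖δ‖ ^ 2) := by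
  have h1 : l1On Finset.univ δ ≤ 4 * l1On S δ := by
    have : l1On Sᶜ δ ≤ 3 * l1On S δ := hδ
    rw [l1On_univ_eq S]; linarith
  have h2 := pow_le_pow_left₀ (l1On_nonneg _ δ) h1 2
  have h3 : (S.card : ℝ) * ‖δ‖ ^ 2 ≤ s * ‖δ‖ ^ 2 := by gcongr
  have := l1On_sq_le S δ
  nlinarith

theorem l1_sq_le_of_mem_coneA₂ {p s : ℕ} {β₀ γ₀ : EuclideanSpace ℝ (Fin p)}
    (hS : (suppSet β₀ γ₀).card ≤ s)
    {δ : EuclideanSpace ℝ (Fin p)} (hδ : δ ∈ coneA₂ β₀ γ₀) :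
    l1On Finset.univ δ ^ 2 ≤ 32 * (s * (‖δ‖ ^ 2 + ‖β₀ - γ₀‖ ^ 2)) := by
  set S := suppSet β₀ γ₀ with hSdef
  have h0 : l1On Finset.univ (β₀ - γ₀) = l1On S (β₀ - γ₀) := by
    refine (Finset.sum_subset (Finset.subset_univ S) fun j _ hj => ?_).symm
    simp only [hSdef, suppSet, Finset.mem_filter, Finset.mem_univ, true_and, not_or,
      not_not] at hj
    simp [hj.1, hj.2]
  have h1 : l1On Finset.univ δ ≤ 4 * l1On S δ + 3 * l1On S (β₀ - γ₀) := by
    have : l1On Sᶜ δ ≤ 3 * l1On S δ + 3 * l1On Finset.univ (β₀ - γ₀) := hδ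
    rw [h0] at this
    rw [l1On_univ_eq S]; linarith
  have h2 := pow_le_pow_left₀ (l1On_nonneg _ δ) h1 2
  have h3 : (S.card : ℝ) * ‖δ‖ ^ 2 ≤ s * ‖δ‖ ^ 2 := by gcongr
  have h4 : (S.card : ℝ) * ‖β₀ - γ₀‖ ^ 2 ≤ s * ‖β₀ - γ₀‖ ^ 2 := by gcongr
  have h5 := l1On_sq_le S δ
  have h6 := l1On_sq_le S (β₀ - γ₀)
  have h7 : 0 ≤ (s : ℝ) * ‖β₀ - γ₀‖ ^ 2 := by positivity
  -- (4a + 3b)² ≤ 32a² + 18b², the difference being (4a − 3b)².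
  nlinarith [sq_nonneg (4 * l1On S δ - 3 * l1On S (β₀ - γ₀))]

end ChangePoint

namespace ChangePoint

/-! ### Moments of squares of subgaussian variables -/

theorem summable_exp_neg_sq_div_four : Summable fun k : ℕ => Real.exp (-(k : ℝ) ^ 2 / 4) := by
  refine Summable.of_nonneg_of_le (fun _ => (Real.exp_pos _).le) (fun k => ?_)
    (Real.summable_exp_nat_mul_iff.2 (by norm_num : (-1 / 4 : ℝ) < 0))
  apply Real.exp_le_exp.2
  have : (k : ℝ) ≤ (k : ℝ) ^ 2 := by
    exact_mod_cast Nat.le_self_pow two_ne_zero k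
  linarith

/-- A bound for `E exp (η² / (4 B))` for every subgaussian `η` with variance parameter at most
`B`. -/
noncomputable def sqMGFBound : ℝ :=
  ∑' k : ℕ, 2 * Real.exp (1 / 2) * Real.exp (-(k : ℝ) ^ 2 / 4)

theorem sqMGFBound_nonneg : 0 ≤ sqMGFBound := tsum_nonneg fun _ => by positivity

/-- With k = ⌊|y|⌋ one has y²/2 = k|y| − k²/2 + (|y| − k)²/2, and the last term is at most 1/2. This
trades the exponential of a square for exponentials of linear functions, which subgaussianity
controls. -/
theorem exp_sq_half_le (y : ℝ) : ∃ k : ℕ, Real.exp (y ^ 2 / 2) ≤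
    Real.exp (1 / 2 - (k : ℝ) ^ 2 / 2) * (Real.exp (k * y) + Real.exp (-k * y)) := by
  refine ⟨⌊|y|⌋₊, ?_⟩
  set k : ℝ := (⌊|y|⌋₊ : ℝ)
  have h1 : k ≤ |y| := Nat.floor_le (abs_nonneg y)
  have h2 : |y| < k + 1 := Nat.lt_floor_add_one _
  have h3 : Real.exp (k * |y|) ≤ Real.exp (k * y) + Real.exp (-k * y) := by
    rcases abs_cases y with ⟨h, _⟩ | ⟨h, _⟩ <;> rw [h]
    · linarith [Real.exp_pos (-k * y)]
    · rw [mul_neg, ← neg_mul]; linarith [Real.exp_pos (k * y)]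
  calc Real.exp (y ^ 2 / 2) ≤ Real.exp (1 / 2 - k ^ 2 / 2 + k * |y|) := by
        apply Real.exp_le_exp.2
        rw [← sq_abs y]
        nlinarith
    _ = Real.exp (1 / 2 - k ^ 2 / 2) * Real.exp (k * |y|) := Real.exp_add _ _
    _ ≤ _ := by gcongr

variable {Ω : Type*} [MeasurableSpace Ω] {P : Measure Ω}

theorem lintegral_exp_sq_le {η : Ω → ℝ} {c : ℝ≥0} {B : ℝ} (hB : 0 < B) (hc : (c : ℝ) ≤ B)
    (h : HasSubgaussianMGF η c P) :
    ∫⁻ ω, ENNReal.ofReal (Real.exp (η ω ^ 2 / (4 * B))) ∂P ≤ ENNReal.ofReal sqMGFBound := by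
  -- Scaled so that (sη)²/2 = η²/(4B). The moment generating function at ±ks is then at most
  -- exp(k²/4), half the exponent gained from exp(−k²/2), so the sum over k converges.
  set s : ℝ := 1 / Real.sqrt (2 * B) with hs
  have hs2 : s ^ 2 = 1 / (2 * B) := by
    rw [hs, div_pow, Real.sq_sqrt (by positivity), one_pow]
  let F : ℕ → Ω → ℝ := fun k ω => Real.exp (1 / 2 - (k : ℝ) ^ 2 / 2) *
    (Real.exp ((k * s) * η ω) + Real.exp ((-k * s) * η ω))
  have hF : ∀ k, Integrable (F k) P := fun k =>
    ((h.integrable_exp_mul _).add (h.integrable_exp_mul _)).const_mul _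
  have hF0 : ∀ k ω, 0 ≤ F k ω := fun k ω => by positivity
  have hFint : ∀ k, ∫ ω, F k ω ∂P ≤ 2 * Real.exp (1 / 2) * Real.exp (-(k : ℝ) ^ 2 / 4) := by
    intro k
    have e : ∀ t : ℝ, t ^ 2 = k ^ 2 * s ^ 2 →
        ∫ ω, Real.exp (t * η ω) ∂P ≤ Real.exp ((k : ℝ) ^ 2 / 4) := by
      intro t ht
      refine (h.mgf_le t).trans (Real.exp_le_exp.2 ?_)
      rw [ht, hs2]
      have : (c : ℝ) * (k ^ 2 * (1 / (2 * B))) / 2 = (c / B) * (k ^ 2 / 4) := by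
        field_simp; ring
      rw [this]
      exact mul_le_of_le_one_left (by positivity) ((div_le_one hB).2 hc)
    calc ∫ ω, F k ω ∂P = Real.exp (1 / 2 - (k : ℝ) ^ 2 / 2) *
          (∫ ω, Real.exp ((k * s) * η ω) ∂P + ∫ ω, Real.exp ((-k * s) * η ω) ∂P) := by
          rw [← integral_add (h.integrable_exp_mul _) (h.integrable_exp_mul _),
            ← integral_const_mul]
      _ ≤ Real.exp (1 / 2 - (k : ℝ) ^ 2 / 2) *
          (Real.exp ((k : ℝ) ^ 2 / 4) + Real.exp ((k : ℝ) ^ 2 / 4)) := by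
          gcongr
          · exact e _ (by ring)
          · exact e _ (by ring)
      _ = 2 * Real.exp (1 / 2) * Real.exp (-(k : ℝ) ^ 2 / 4) := by
          rw [mul_assoc, ← Real.exp_add, ← two_mul, mul_left_comm, ← Real.exp_add]
          ring_nf
  calc ∫⁻ ω, ENNReal.ofReal (Real.exp (η ω ^ 2 / (4 * B))) ∂P
      ≤ ∫⁻ ω, ∑' k, ENNReal.ofReal (F k ω) ∂P := by
        refine lintegral_mono fun ω => ?_
        obtain ⟨k, hk⟩ := exp_sq_half_le (s * η ω)
        refine le_trans (ENNReal.ofReal_le_ofReal ?_) (ENNReal.le_tsum k)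
        convert hk using 2
        · rw [mul_pow, hs2]; field_simp; ring
        · simp only [mul_assoc]
    _ = ∑' k, ∫⁻ ω, ENNReal.ofReal (F k ω) ∂P :=
        lintegral_tsum fun k => (hF k).aemeasurable.ennreal_ofReal
    _ = ∑' k, ENNReal.ofReal (∫ ω, F k ω ∂P) := by
        refine tsum_congr fun k => ?_
        rw [ofReal_integral_eq_lintegral_ofReal (hF k) (Eventually.of_forall (hF0 k))]
    _ ≤ ∑' k : ℕ, ENNReal.ofReal (2 * Real.exp (1 / 2) * Real.exp (-(k : ℝ) ^ 2 / 4)) :=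
        ENNReal.tsum_le_tsum fun k => ENNReal.ofReal_le_ofReal (hFint k)
    _ = ENNReal.ofReal sqMGFBound :=
        (ENNReal.ofReal_tsum_of_nonneg (fun _ => by positivity)
          (summable_exp_neg_sq_div_four.mul_left _)).symm

theorem integrable_exp_sq {η : Ω → ℝ} {c : ℝ≥0} {B : ℝ} (hη : Measurable η) (hB : 0 < B)
    (hc : (c : ℝ) ≤ B) (h : HasSubgaussianMGF η c P) :
    Integrable (fun ω => Real.exp (η ω ^ 2 / (4 * B))) P := by
  refine (lintegral_ofReal_ne_top_iff_integrable ?_ ?_).1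
    ((lintegral_exp_sq_le hB hc h).trans_lt ENNReal.ofReal_lt_top).ne
  · exact (Real.measurable_exp.comp ((hη.pow_const 2).div_const _)).aestronglyMeasurable
  · exact Eventually.of_forall fun _ => (Real.exp_pos _).le

theorem integral_exp_sq_le {η : Ω → ℝ} {c : ℝ≥0} {B : ℝ} (hη : Measurable η) (hB : 0 < B)
    (hc : (c : ℝ) ≤ B) (h : HasSubgaussianMGF η c P) :
    ∫ ω, Real.exp (η ω ^ 2 / (4 * B)) ∂P ≤ sqMGFBound := by
  have := lintegral_exp_sq_le hB hc h
  rw [← ofReal_integral_eq_lintegral_ofReal (integrable_exp_sq hη hB hc h)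
    (Eventually.of_forall fun _ => (Real.exp_pos _).le)] at this
  exact (ENNReal.ofReal_le_ofReal_iff sqMGFBound_nonneg).1 this

/-- Because exp x ≥ 1 + x + x²/2 and (1 − x + x²/2)(1 + x + x²/2) = 1 + x⁴/4 ≥ 1. -/
theorem exp_neg_le_quadratic {x : ℝ} (hx : 0 ≤ x) : Real.exp (-x) ≤ 1 - x + x ^ 2 / 2 := by
  rw [Real.exp_neg]
  have h := Real.quadratic_le_exp_of_nonneg hx
  have h1 : 0 ≤ 1 - x + x ^ 2 / 2 := by nlinarith [sq_nonneg (x - 1)]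
  rw [inv_le_iff_one_le_mul₀ (Real.exp_pos x)]
  nlinarith [mul_le_mul_of_nonneg_left h h1, sq_nonneg (x ^ 2)]

/-- The Laplace transform of `η²` for a subgaussian `η` whose second moment is at least `κ`. -/
theorem integral_exp_neg_sq_le {η : Ω → ℝ} {c : ℝ≥0} {B κ t : ℝ} [IsProbabilityMeasure P]
    (hη : Measurable η) (hB : 0 < B)
    (hc : (c : ℝ) ≤ B) (h : HasSubgaussianMGF η c P) (hκ : κ ≤ ∫ ω, η ω ^ 2 ∂P) (ht : 0 ≤ t) :
    ∫ ω, Real.exp (-(t * η ω ^ 2)) ∂P ≤ 1 - t * κ + t ^ 2 * (16 * B ^ 2 * sqMGFBound) := by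
  have hI := integrable_exp_sq hη hB hc h
  have hb : ∀ z : ℝ, 0 ≤ z → 1 + z / (4 * B) + (z / (4 * B)) ^ 2 / 2 ≤ Real.exp (z / (4 * B)) :=
    fun z hz => Real.quadratic_le_exp_of_nonneg (by positivity)
  have h2 : Integrable (fun ω => η ω ^ 2) P := (h.memLp 2).integrable_sq
  have h2' : Integrable (fun ω => 1 - t * η ω ^ 2) P := (integrable_const _).sub (h2.const_mul _)
  have hle : ∀ ω, Real.exp (-(t * η ω ^ 2)) ≤
      1 - t * η ω ^ 2 + t ^ 2 * (16 * B ^ 2) * Real.exp (η ω ^ 2 / (4 * B)) := by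
    intro ω
    refine (exp_neg_le_quadratic (mul_nonneg ht (sq_nonneg _))).trans ?_
    have h1 := hb (η ω ^ 2) (sq_nonneg _)
    -- The fourth power is dominated through the quadratic term of the exponential series at
    -- η²/(4B).
    have h3 : (η ω ^ 2) ^ 2 / 2 ≤ 16 * B ^ 2 * Real.exp (η ω ^ 2 / (4 * B)) := by
      have h4 : (η ω ^ 2 / (4 * B)) ^ 2 / 2 ≤ Real.exp (η ω ^ 2 / (4 * B)) := by
        have : 0 ≤ η ω ^ 2 / (4 * B) := by positivity
        linarith
      calc (η ω ^ 2) ^ 2 / 2 = 16 * B ^ 2 * ((η ω ^ 2 / (4 * B)) ^ 2 / 2) := by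
            field_simp; ring
        _ ≤ _ := by gcongr
    have := mul_le_mul_of_nonneg_left h3 (sq_nonneg t)
    nlinarith
  calc ∫ ω, Real.exp (-(t * η ω ^ 2)) ∂P
      ≤ ∫ ω, (1 - t * η ω ^ 2 + t ^ 2 * (16 * B ^ 2) * Real.exp (η ω ^ 2 / (4 * B))) ∂P :=
        integral_mono_of_nonneg (Eventually.of_forall fun _ => (Real.exp_pos _).le)
          (h2'.add (hI.const_mul _))
          (Eventually.of_forall hle)
    _ = 1 - t * ∫ ω, η ω ^ 2 ∂P +
          t ^ 2 * (16 * B ^ 2) * ∫ ω, Real.exp (η ω ^ 2 / (4 * B)) ∂P := by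
        rw [integral_add h2' (hI.const_mul _),
          integral_sub (integrable_const _) (h2.const_mul _), integral_const_mul,
          integral_const_mul]
        simp
    _ ≤ _ := by
        have h5 := integral_exp_sq_le hη hB hc h
        have h6 := mul_le_mul_of_nonneg_left h5 (by positivity : 0 ≤ t ^ 2 * (16 * B ^ 2))
        have h7 := mul_le_mul_of_nonneg_left hκ ht
        linarith

/-! ### Independence of pairs and thinned sums -/

/-- Measurable rectangles form a π-system generating the product σ-algebra. On them, independence of
the two samples separates X from W, and independence within each sample then factors over the
indices. -/
theorem iIndepFun_prodMk {ι : Type*} [Fintype ι] {α β : Type*} [MeasurableSpace α]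
    [MeasurableSpace β] {X : ι → Ω → α} {W : ι → Ω → β}
    (mX : ∀ i, Measurable (X i)) (mW : ∀ i, Measurable (W i))
    (hX : iIndepFun X P) (hW : iIndepFun W P)
    (hXW : IndepFun (fun ω i => X i ω) (fun ω i => W i ω) P) :
    iIndepFun (fun i ω => (X i ω, W i ω)) P := by
  classical
  have hXW1 : ∀ i, IndepFun (X i) (W i) P := fun i =>
    hXW.comp (measurable_pi_apply i) (measurable_pi_apply i)
  refine iIndepSets.iIndep (fun i => ((mX i).prodMk (mW i)).comap_le)
    (fun i => {s | ∃ t ∈ Set.image2 (fun (a : Set α) (b : Set β) => a ×ˢ b)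
      {a | MeasurableSet a} {b | MeasurableSet b}, (fun ω => (X i ω, W i ω)) ⁻¹' t = s})
    (fun i => isPiSystem_prod.comap _) (fun i => ?_) ?_
  · rw [← generateFrom_prod, MeasurableSpace.comap_generateFrom]
    rfl
  · rw [iIndepSets_iff]
    intro S f hf
    have hf' : ∀ i, ∃ a : Set α, ∃ b : Set β, MeasurableSet a ∧ MeasurableSet b ∧
        (i ∈ S → f i = X i ⁻¹' a ∩ W i ⁻¹' b) := by
      intro i
      by_cases hi : i ∈ S
      · obtain ⟨t, ⟨a, ha, b, hb, rfl⟩, ht⟩ := hf i hi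
        exact ⟨a, b, ha, hb, fun _ => by rw [← ht]; rfl⟩
      · exact ⟨∅, ∅, .empty, .empty, fun h => absurd h hi⟩
    choose a b ha hb hab using hf'
    have e1 : ⋂ i ∈ S, f i = (fun ω i => X i ω) ⁻¹' ((S : Set ι).pi a) ∩
        (fun ω i => W i ω) ⁻¹' ((S : Set ι).pi b) := by
      ext ω
      simp only [Set.mem_iInter, Set.mem_inter_iff, Set.mem_preimage, Set.mem_pi,
        Finset.mem_coe]
      constructor
      · intro h
        exact ⟨fun i hi => ((hab i hi) ▸ h i hi).1, fun i hi => ((hab i hi) ▸ h i hi).2⟩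
      · intro h i hi
        rw [hab i hi]
        exact ⟨h.1 i hi, h.2 i hi⟩
    have e2 : (fun ω i => X i ω) ⁻¹' ((S : Set ι).pi a) = ⋂ i ∈ S, X i ⁻¹' a i := by
      ext ω; simp
    have e3 : (fun ω i => W i ω) ⁻¹' ((S : Set ι).pi b) = ⋂ i ∈ S, W i ⁻¹' b i := by
      ext ω; simp
    rw [e1, hXW.measure_inter_preimage_eq_mul _ _
      (MeasurableSet.pi S.countable_toSet fun i _ => ha i)
      (MeasurableSet.pi S.countable_toSet fun i _ => hb i), e2, e3,
      hX.measure_inter_preimage_eq_mul S fun i _ => ha i,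
      hW.measure_inter_preimage_eq_mul S fun i _ => hb i, ← Finset.prod_mul_distrib]
    refine Finset.prod_congr rfl fun i hi => ?_
    rw [hab i hi, (hXW1 i).measure_inter_preimage_eq_mul _ _ (ha i) (hb i)]

/-- `1_A(w) z`. -/
noncomputable def thin (A : Set ℝ) (w z : ℝ) : ℝ := A.indicator 1 w * z

theorem exp_mul_thin (A : Set ℝ) (t w z : ℝ) :
    Real.exp (t * thin A w z) = 1 + A.indicator 1 w * (Real.exp (t * z) - 1) := by
  by_cases h : w ∈ A <;> simp [thin, h]

theorem measurable_thin {A : Set ℝ} (hA : MeasurableSet A) {w z : Ω → ℝ} (hw : Measurable w)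
    (hz : Measurable z) : Measurable fun ω => thin A (w ω) (z ω) :=
  (((measurable_one.indicator hA)).comp hw).mul hz

theorem integrable_exp_mul_thin [IsProbabilityMeasure P] {A : Set ℝ} (hA : MeasurableSet A)
    {w z : Ω → ℝ} (hw : Measurable w) {t : ℝ}
    (hI : Integrable (fun ω => Real.exp (t * z ω)) P) :
    Integrable (fun ω => Real.exp (t * thin A (w ω) (z ω))) P := by
  simp only [exp_mul_thin]
  refine (integrable_const _).add ((hI.sub (integrable_const 1)).bdd_mul (c := 1)
    ((measurable_one.indicator hA).comp hw).aestronglyMeasurable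
    (Eventually.of_forall fun ω => ?_))
  by_cases h : w ω ∈ A <;> simp [h]

/-- Off `A` the exponential is 1, so thinning multiplies E exp(tz) − 1 by the mass of `A`. This is
the source of the rate n ν(A) in the tail bounds. -/
theorem mgf_thin [IsProbabilityMeasure P] {A : Set ℝ} (hA : MeasurableSet A) {ν : Measure ℝ}
    {w z : Ω → ℝ} (hw : Measurable w) (hl : HasLaw w ν P) (hwz : IndepFun w z P) {t : ℝ}
    (hI : Integrable (fun ω => Real.exp (t * z ω)) P) :
    mgf (fun ω => thin A (w ω) (z ω)) P t =
      1 + ν.real A * (∫ ω, Real.exp (t * z ω) ∂P - 1) := by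
  have mi : Measurable (fun x : ℝ => A.indicator (1 : ℝ → ℝ) x) := measurable_one.indicator hA
  have hJ : Integrable (fun ω => Real.exp (t * z ω) - 1) P := hI.sub (integrable_const 1)
  have hJ' : Integrable (fun ω => A.indicator 1 (w ω) * (Real.exp (t * z ω) - 1)) P := by
    refine hJ.bdd_mul (c := 1) (mi.comp hw).aestronglyMeasurable
      (Eventually.of_forall fun ω => ?_)
    by_cases h : w ω ∈ A <;> simp [h]
  have hind : IndepFun (fun ω => A.indicator (1 : ℝ → ℝ) (w ω))
      (fun ω => Real.exp (t * z ω) - 1) P :=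
    hwz.comp (φ := fun x => A.indicator (1 : ℝ → ℝ) x) (ψ := fun x => Real.exp (t * x) - 1) mi
      (by fun_prop)
  have hq : ∫ ω, A.indicator (1 : ℝ → ℝ) (w ω) ∂P = ν.real A := by
    have h1 := hl.integral_comp (f := fun x => A.indicator (1 : ℝ → ℝ) x) mi.aestronglyMeasurable
    rw [show (fun x => A.indicator (1 : ℝ → ℝ) x) = A.indicator 1 from rfl,
      integral_indicator_one hA] at h1
    exact h1
  simp only [mgf, exp_mul_thin]
  rw [integral_add (integrable_const _) hJ',
    hind.integral_fun_mul_eq_mul_integral (mi.comp hw).aestronglyMeasurable hJ.1, hq,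
    integral_sub hI (integrable_const _)]
  simp

end ChangePoint

namespace ChangePoint

/-! ### Tail bounds for a fixed direction -/

/-- Subtracting κ times the identity shifts the spectrum into the nonnegative reals, so the
difference is positive semidefinite. -/
theorem le_dotProduct_mulVec_of_spectrum {ι : Type*} [Fintype ι] [DecidableEq ι]
    {M : Matrix ι ι ℝ} (hM : M.IsHermitian) {κ φ : ℝ} (h : spectrum ℝ M ⊆ Set.Icc κ φ)
    (v : ι → ℝ) : κ * ∑ j, v j ^ 2 ≤ v ⬝ᵥ M.mulVec v := by
  have hp : (M - algebraMap ℝ (Matrix ι ι ℝ) κ).PosSemidef := by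
    rw [Matrix.posSemidef_iff_isHermitian_and_spectrum_nonneg]
    refine ⟨hM.sub ?_, ?_⟩
    · rw [Algebra.algebraMap_eq_smul_one]
      simp [Matrix.IsHermitian]
    · rw [← spectrum.sub_singleton_eq]
      rintro _ ⟨a, ha, b, rfl, rfl⟩
      exact sub_nonneg.2 (h ha).1
  have := hp.dotProduct_mulVec_nonneg v
  rw [Matrix.sub_mulVec, dotProduct_sub, Algebra.algebraMap_eq_smul_one, Matrix.smul_mulVec,
    Matrix.one_mulVec, dotProduct_smul] at this
  simp only [star_trivial, smul_eq_mul] at this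
  have e : ∑ j, v j ^ 2 = v ⬝ᵥ v := by simp [dotProduct, sq]
  rw [e]
  linarith

variable {n p : ℕ} {Ω : Type*} [MeasurableSpace Ω] {P : Measure Ω}
  {X : Fin n → Ω → EuclideanSpace ℝ (Fin p)} {W ε : Fin n → Ω → ℝ} {ν : Measure ℝ}
  {κ φ C : ℝ}

theorem ConditionB.measurable_inner (hB : ConditionB P X W ε ν κ φ C) (i : Fin n)
    (v : EuclideanSpace ℝ (Fin p)) : Measurable fun ω => inner ℝ (X i ω) v :=
  (hB.measurable_X i).inner_const

theorem ConditionB.le_integral_inner_sq (hB : ConditionB P X W ε ν κ φ C) (i : Fin n)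
    (v : EuclideanSpace ℝ (Fin p)) (hv : ‖v‖ = 1) :
    κ ≤ ∫ ω, (inner ℝ (X i ω) v) ^ 2 ∂P := by
  obtain ⟨c, -, hc⟩ := hB.subgaussian_X
  have hL : ∀ j, MemLp (fun ω => X i ω j) 2 P := fun j => by
    have := (hc i (EuclideanSpace.single j 1) (by simp)).memLp 2
    simpa [EuclideanSpace.inner_single_right] using this
  have hI : ∀ j k, Integrable (fun ω => X i ω j * X i ω k) P := fun j k =>
    (hL j).integrable_mul (hL k)
  have e : ∫ ω, (inner ℝ (X i ω) v) ^ 2 ∂P =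
      (v : Fin p → ℝ) ⬝ᵥ (secondMoment P (X i)).mulVec v := by
    have e1 : ∀ ω, (inner ℝ (X i ω) v) ^ 2 =
        ∑ j, ∑ k, v j * v k * (X i ω j * X i ω k) := fun ω => by
      rw [PiLp.inner_apply, sq, Finset.sum_mul_sum]
      refine Finset.sum_congr rfl fun j _ => Finset.sum_congr rfl fun k _ => ?_
      simp; ring
    simp only [e1]
    rw [integral_finsetSum _ fun j _ => integrable_finsetSum _ fun k _ => (hI j k).const_mul _]
    simp only [dotProduct, Matrix.mulVec, secondMoment, Matrix.of_apply, Finset.mul_sum]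
    refine Finset.sum_congr rfl fun j _ => ?_
    rw [integral_finsetSum _ fun k _ => (hI j k).const_mul _]
    refine Finset.sum_congr rfl fun k _ => ?_
    rw [integral_const_mul]
    ring
  have hM : (secondMoment P (X i)).IsHermitian := by
    ext j k
    simp [secondMoment, mul_comm]
  have h := le_dotProduct_mulVec_of_spectrum hM (hB.eigenvalues_X i) v
  have hv' : ∑ j, v j ^ 2 = 1 := by
    have := EuclideanSpace.norm_sq_eq v
    rw [hv] at this
    simpa using this.symm
  rw [e]
  rwa [hv', mul_one] at h

open Classical in
/-- The indices `i` with `wᵢ ∈ A`. -/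
noncomputable def idxIn {n : ℕ} (w : Fin n → ℝ) (A : Set ℝ) : Finset (Fin n) :=
  Finset.univ.filter fun i => w i ∈ A

theorem gramForm_idxIn {n p : ℕ} (x : Fin n → EuclideanSpace ℝ (Fin p)) (w : Fin n → ℝ)
    (A : Set ℝ) (δ : EuclideanSpace ℝ (Fin p)) :
    gramForm x (idxIn w A) δ = (1 / (n : ℝ)) * ∑ i, thin A (w i) ((inner ℝ (x i) δ) ^ 2) := by
  classical
  rw [gramForm, idxIn, Finset.sum_filter]
  congr 1
  refine Finset.sum_congr rfl fun i _ => ?_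
  by_cases h : w i ∈ A <;> simp [thin, h]

theorem ConditionB.measurable_gramForm (hB : ConditionB P X W ε ν κ φ C) {A : Set ℝ}
    (hA : MeasurableSet A) (δ : EuclideanSpace ℝ (Fin p)) :
    Measurable fun ω => gramForm (fun i => X i ω) (idxIn (fun i => W i ω) A) δ := by
  simp only [gramForm_idxIn]
  exact (Finset.measurable_sum _ fun i _ => measurable_thin hA (hB.measurable_W i)
    ((hB.measurable_inner i δ).pow_const 2)).const_mul _

theorem ConditionB.mgf_sum_thin [IsProbabilityMeasure P] (hB : ConditionB P X W ε ν κ φ C)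
    {A : Set ℝ} (hA : MeasurableSet A) (δ : EuclideanSpace ℝ (Fin p)) {t L : ℝ}
    (hI : ∀ i, Integrable (fun ω => Real.exp (t * (inner ℝ (X i ω) δ) ^ 2)) P)
    (h : ∀ i, 1 + ν.real A * (∫ ω, Real.exp (t * (inner ℝ (X i ω) δ) ^ 2) ∂P - 1) ≤ L) :
    Integrable (fun ω => Real.exp (t * ∑ i, thin A (W i ω) ((inner ℝ (X i ω) δ) ^ 2))) P ∧
    mgf (fun ω => ∑ i, thin A (W i ω) ((inner ℝ (X i ω) δ) ^ 2)) P t ≤ L ^ n := by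
  have hind := iIndepFun_prodMk hB.measurable_X hB.measurable_W hB.iIndep_X hB.iIndep_W
    hB.indep_X_W
  have hY : iIndepFun (fun i ω => thin A (W i ω) ((inner ℝ (X i ω) δ) ^ 2)) P :=
    hind.comp (fun _ z => thin A z.2 ((inner ℝ z.1 δ) ^ 2)) fun _ =>
      measurable_thin hA measurable_snd (measurable_fst.inner_const.pow_const 2)
  have mY : ∀ i, Measurable fun ω => thin A (W i ω) ((inner ℝ (X i ω) δ) ^ 2) := fun i =>
    measurable_thin hA (hB.measurable_W i) ((hB.measurable_inner i δ).pow_const 2)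
  have e : (fun ω => ∑ i, thin A (W i ω) ((inner ℝ (X i ω) δ) ^ 2)) =
      ∑ i, fun ω => thin A (W i ω) ((inner ℝ (X i ω) δ) ^ 2) := by
    ext ω; simp
  have hwz : ∀ i, IndepFun (W i) (fun ω => (inner ℝ (X i ω) δ) ^ 2) P := fun i =>
    (hB.indep_X_W.comp (φ := fun x : Fin n → EuclideanSpace ℝ (Fin p) => (inner ℝ (x i) δ) ^ 2)
      (ψ := fun w : Fin n → ℝ => w i)
      ((measurable_pi_apply i).inner_const.pow_const 2) (measurable_pi_apply i)).symm
  constructor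
  · have := hY.integrable_exp_mul_sum mY (t := t) (s := Finset.univ) fun i _ =>
      integrable_exp_mul_thin hA (hB.measurable_W i) (hI i)
    simpa using this
  · rw [e, hY.mgf_sum mY]
    calc _ ≤ ∏ _i : Fin n, L := Finset.prod_le_prod (fun i _ => mgf_nonneg) fun i _ => by
          rw [mgf_thin hA (hB.measurable_W i) (hB.law_W i) (hwz i) (hI i)]
          exact h i
      _ = L ^ n := by simp

/-- Chernoff's bound at t = 1/(4B), where the exponential moment of the square is bounded by
`sqMGFBound`. Any upper bound `q` on the mass is allowed, so that it can later be kept above log p /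
n. At z = 0 the event is the whole space, hence the exclusion. -/
theorem ConditionB.measureReal_gramForm_ge [IsProbabilityMeasure P]
    (hB : ConditionB P X W ε ν κ φ C) (hn : 0 < n) {A : Set ℝ} (hA : MeasurableSet A) {B : ℝ}
    (hB0 : 0 < B) (hCB : C ≤ B) {q θ : ℝ} (hq : ν.real A ≤ q)
    (z : EuclideanSpace ℝ (Fin p)) (hz : z ≠ 0) :
    P.real {ω | θ * ‖z‖ ^ 2 ≤ gramForm (fun i => X i ω) (idxIn (fun i => W i ω) A) z} ≤
      Real.exp (n * q * sqMGFBound - n * θ / (4 * B)) := by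
  have hz' : 0 < ‖z‖ := norm_pos_iff.2 hz
  have hn' : (0 : ℝ) < n := by exact_mod_cast hn
  set δ := ‖z‖⁻¹ • z with hδ
  have hδ1 : ‖δ‖ = 1 := by
    rw [hδ, norm_smul, norm_inv, norm_norm, inv_mul_cancel₀ hz'.ne']
  have hzδ : z = ‖z‖ • δ := by rw [hδ, smul_smul, mul_inv_cancel₀ hz'.ne', one_smul]
  obtain ⟨c, hcC, hc⟩ := hB.subgaussian_X
  have e4 : ∀ y : ℝ, 1 / (4 * B) * y = y / (4 * B) := fun y => by ring
  have hI : ∀ i, Integrable (fun ω => Real.exp (1 / (4 * B) * (inner ℝ (X i ω) δ) ^ 2)) P :=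
    fun i => by
      simp only [e4]
      exact integrable_exp_sq (hB.measurable_inner i δ) hB0 (hcC.trans hCB) (hc i δ hδ1)
  have hq0 : 0 ≤ q := measureReal_nonneg.trans hq
  obtain ⟨h1, h2⟩ := hB.mgf_sum_thin hA δ (t := 1 / (4 * B)) (L := Real.exp (q * sqMGFBound)) hI fun i => by
      have h3 : ∫ ω, Real.exp (1 / (4 * B) * (inner ℝ (X i ω) δ) ^ 2) ∂P ≤ sqMGFBound := by
        simp only [e4]
        exact integral_exp_sq_le (hB.measurable_inner i δ) hB0 (hcC.trans hCB) (hc i δ hδ1)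
      have h4 := Real.add_one_le_exp (q * sqMGFBound)
      have h5 := mul_le_mul_of_nonneg_left h3 (measureReal_nonneg (μ := ν) (s := A))
      have h6 := mul_le_mul_of_nonneg_right hq sqMGFBound_nonneg
      have h7 := measureReal_nonneg (μ := ν) (s := A)
      nlinarith
  have hset : {ω | θ * ‖z‖ ^ 2 ≤ gramForm (fun i => X i ω) (idxIn (fun i => W i ω) A) z} =
      {ω | n * θ ≤ ∑ i, thin A (W i ω) ((inner ℝ (X i ω) δ) ^ 2)} := by
    ext ω
    simp only [Set.mem_ofPred_eq]
    conv_lhs => rw [hzδ, gramForm_smul, norm_smul, norm_norm, hδ1, mul_one, mul_comm,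
      mul_le_mul_iff_right₀ (by positivity : 0 < ‖z‖ ^ 2), gramForm_idxIn, one_div,
      ← div_eq_inv_mul, le_div_iff₀ hn', mul_comm]
  rw [hset]
  refine (measure_ge_le_exp_mul_mgf _ (by positivity) h1).trans ?_
  refine (mul_le_mul_of_nonneg_left h2 (Real.exp_pos _).le).trans ?_
  rw [← Real.exp_nat_mul, ← Real.exp_add]
  apply le_of_eq
  congr 1
  ring

/-- The rate in the lower tail bound. -/
noncomputable def lowerRate (κ B : ℝ) : ℝ := κ ^ 2 / (128 * B ^ 2 * (sqMGFBound + 1))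

theorem lowerRate_pos {κ B : ℝ} (hκ : 0 < κ) (hB : 0 < B) : 0 < lowerRate κ B := by
  have := sqMGFBound_nonneg
  unfold lowerRate; positivity

theorem ConditionB.measureReal_gramForm_lt [IsProbabilityMeasure P]
    (hB : ConditionB P X W ε ν κ φ C) (hκ : 0 < κ) (hn : 0 < n) {A : Set ℝ}
    (hA : MeasurableSet A) {B : ℝ}
    (hB0 : 0 < B) (hCB : C ≤ B) (z : EuclideanSpace ℝ (Fin p)) :
    P.real {ω | gramForm (fun i => X i ω) (idxIn (fun i => W i ω) A) z <
      κ / 4 * ν.real A * ‖z‖ ^ 2} ≤ Real.exp (-(n * ν.real A * lowerRate κ B)) := by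
  rcases eq_or_ne z 0 with rfl | hz
  · have : {ω | gramForm (fun i => X i ω) (idxIn (fun i => W i ω) A)
        (0 : EuclideanSpace ℝ (Fin p)) <
        κ / 4 * ν.real A * ‖(0 : EuclideanSpace ℝ (Fin p))‖ ^ 2} = ∅ := by
      ext ω; simp [gramForm]
    rw [this, measureReal_empty]
    exact (Real.exp_pos _).le
  have hK := sqMGFBound_nonneg
  set q := ν.real A with hqdef
  have hq0 : 0 ≤ q := measureReal_nonneg
  have hz' : 0 < ‖z‖ := norm_pos_iff.2 hz
  have hn' : (0 : ℝ) < n := by exact_mod_cast hn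
  set δ := ‖z‖⁻¹ • z with hδ
  have hδ1 : ‖δ‖ = 1 := by
    rw [hδ, norm_smul, norm_inv, norm_norm, inv_mul_cancel₀ hz'.ne']
  have hzδ : z = ‖z‖ • δ := by rw [hδ, smul_smul, mul_inv_cancel₀ hz'.ne', one_smul]
  obtain ⟨c, hcC, hc⟩ := hB.subgaussian_X
  -- Small enough that the quadratic term of the Laplace bound is at most half of the linear term
  -- tκ. Chernoff at level κq/4 then leaves the exponent −nq·tκ/4, and tκ/4 is `lowerRate`.
  set t : ℝ := κ / (32 * B ^ 2 * (sqMGFBound + 1)) with ht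
  have ht0 : 0 < t := by positivity
  have hI : ∀ i, Integrable (fun ω => Real.exp (-t * (inner ℝ (X i ω) δ) ^ 2)) P :=
    fun i => by
      refine (integrable_const (1 : ℝ)).mono' (Real.measurable_exp.comp
        (((hB.measurable_inner i δ).pow_const 2).const_mul _)).aestronglyMeasurable
        (Eventually.of_forall fun ω => ?_)
      rw [Real.norm_of_nonneg (Real.exp_pos _).le, Real.exp_le_one_iff, neg_mul]
      exact neg_nonpos.2 (by positivity)
  obtain ⟨h1, h2⟩ := hB.mgf_sum_thin hA δ (t := -t) (L := Real.exp (-(q * (t * κ / 2)))) hI fun i => by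
      have h3 := integral_exp_neg_sq_le (hB.measurable_inner i δ) hB0 (hcC.trans hCB) (hc i δ hδ1)
        (hB.le_integral_inner_sq i δ hδ1) ht0.le
      simp only [← neg_mul] at h3
      have h4 := Real.add_one_le_exp (-(q * (t * κ / 2)))
      have h5 : t ^ 2 * (16 * B ^ 2 * sqMGFBound) ≤ t * κ / 2 := by
        have : t * (32 * B ^ 2 * (sqMGFBound + 1)) = κ := by rw [ht]; field_simp
        nlinarith [mul_pos ht0 (mul_pos ht0 (pow_pos hB0 2))]
      have h6 : ∫ ω, Real.exp (-t * (inner ℝ (X i ω) δ) ^ 2) ∂P - 1 ≤ -(t * κ / 2) := by linarith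
      have h7 := mul_le_mul_of_nonneg_left h6 hq0
      linarith
  have hset : {ω | gramForm (fun i => X i ω) (idxIn (fun i => W i ω) A) z <
      κ / 4 * q * ‖z‖ ^ 2} ⊆
      {ω | ∑ i, thin A (W i ω) ((inner ℝ (X i ω) δ) ^ 2) ≤ n * (κ / 4 * q)} := by
    intro ω hω
    simp only [Set.mem_ofPred_eq] at hω ⊢
    rw [hzδ, gramForm_smul, norm_smul, norm_norm, hδ1, mul_one, mul_comm (κ / 4 * q),
      mul_lt_mul_iff_right₀ (by positivity : 0 < ‖z‖ ^ 2), gramForm_idxIn, one_div,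
      ← div_eq_inv_mul, div_lt_iff₀ hn', mul_comm] at hω
    exact hω.le
  refine (measureReal_mono hset).trans
    ((measure_le_le_exp_mul_mgf _ (neg_nonpos.2 ht0.le) h1).trans ?_)
  refine (mul_le_mul_of_nonneg_left h2 (Real.exp_pos _).le).trans ?_
  rw [← Real.exp_nat_mul, ← Real.exp_add]
  apply le_of_eq
  congr 1
  have : lowerRate κ B = t * κ / 4 := by rw [ht, lowerRate]; field_simp; norm_num
  rw [this]
  ring

end ChangePoint

namespace ChangePoint

/-! ### Uniform bounds over all directions -/

theorem exists_event_of_forall_le {Ω F : Type*} [MeasurableSpace Ω] {P : Measure Ω}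
    [IsProbabilityMeasure P] [Fintype F] {bad : F → Set Ω} (hm : ∀ f, MeasurableSet (bad f))
    {b : ℝ} (hb : ∀ f, P.real (bad f) ≤ b) :
    ∃ E : Set Ω, MeasurableSet E ∧ 1 - Fintype.card F * b ≤ P.real E ∧
      ∀ ω ∈ E, ∀ f, ω ∉ bad f := by
  refine ⟨(⋃ f, bad f)ᶜ, (MeasurableSet.iUnion hm).compl, ?_, fun ω hω f hf =>
    hω (Set.mem_iUnion.2 ⟨f, hf⟩)⟩
  rw [probReal_compl_eq_one_sub (MeasurableSet.iUnion hm)]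
  have := (measureReal_iUnion_fintype_le (μ := P) bad).trans
    (Finset.sum_le_sum fun f _ => hb f)
  simp only [Finset.sum_const, Finset.card_univ, nsmul_eq_mul] at this
  linarith

theorem exists_event_inter {Ω : Type*} [MeasurableSpace Ω] {P : Measure Ω}
    [IsProbabilityMeasure P] {a b : ℝ} {p q : Ω → Prop}
    (h₁ : ∃ E : Set Ω, MeasurableSet E ∧ 1 - a ≤ P.real E ∧ ∀ ω ∈ E, p ω)
    (h₂ : ∃ E : Set Ω, MeasurableSet E ∧ 1 - b ≤ P.real E ∧ ∀ ω ∈ E, q ω) :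
    ∃ E : Set Ω, MeasurableSet E ∧ 1 - (a + b) ≤ P.real E ∧ ∀ ω ∈ E, p ω ∧ q ω := by
  obtain ⟨E, hE, hEa, hEp⟩ := h₁
  obtain ⟨F, hF, hFb, hFq⟩ := h₂
  refine ⟨E ∩ F, hE.inter hF, ?_, fun ω hω => ⟨hEp ω hω.1, hFq ω hω.2⟩⟩
  have h1 := measureReal_union_add_inter (μ := P) (s := E) hF
  have h2 : P.real (E ∪ F) ≤ 1 := measureReal_le_one
  linarith

theorem card_signedTuples_le {p : ℕ} (hp : 2 ≤ p) (k : ℕ) :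
    (Fintype.card (Fin k → Fin p × Bool) : ℝ) ≤ Real.exp (k * (2 * Real.log p)) := by
  have hp' : (2 : ℝ) ≤ p := by exact_mod_cast hp
  have h : (p : ℝ) * 2 ≤ Real.exp (2 * Real.log p) := by
    rw [two_mul, Real.exp_add, Real.exp_log (by linarith)]
    gcongr
  rw [Real.exp_nat_mul]
  simp only [Fintype.card_pi, Fintype.card_prod, Fintype.card_fin, Fintype.card_bool,
    Finset.prod_const, Finset.card_univ]
  push_cast
  exact pow_le_pow_left₀ (by positivity) h k

/-- The constant in the uniform upper bound. -/
noncomputable def upperConst (B : ℝ) : ℝ := 4 * B * (sqMGFBound + 7)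

theorem upperConst_pos {B : ℝ} (hB : 0 < B) : 0 < upperConst B := by
  have := sqMGFBound_nonneg
  unfold upperConst; positivity

/-- The constant multiplying the `ℓ₁` term in the uniform lower bound. -/
noncomputable def lowerConst (κ B : ℝ) : ℝ :=
  κ / lowerRate κ B + 32 * upperConst B * (1 / lowerRate κ B + 1)

theorem lowerConst_pos {κ B : ℝ} (hκ : 0 < κ) (hB : 0 < B) : 0 < lowerConst κ B := by
  have := lowerRate_pos hκ hB
  have := upperConst_pos hB
  unfold lowerConst; positivity

variable {n p : ℕ} {Ω : Type*} [MeasurableSpace Ω] {P : Measure Ω}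
  {X : Fin n → Ω → EuclideanSpace ℝ (Fin p)} {W ε : Fin n → Ω → ℝ} {ν : Measure ℝ}
  {κ φ C : ℝ}

theorem ConditionB.exists_event_gramForm_le [IsProbabilityMeasure P]
    (hB : ConditionB P X W ε ν κ φ C) (hn : 0 < n) (hp : 2 ≤ p) {A : Set ℝ}
    (hA : MeasurableSet A) {B : ℝ} (hB0 : 0 < B) (hCB : C ≤ B) {q : ℝ} (hq : ν.real A ≤ q)
    (hpq : Real.log p / n ≤ q) :
    ∃ E : Set Ω, MeasurableSet E ∧ 1 - Real.exp (-(n * q)) ≤ P.real E ∧ ∀ ω ∈ E, ∀ δ,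
      gramForm (fun i => X i ω) (idxIn (fun i => W i ω) A) δ ≤
        upperConst B * (q * ‖δ‖ ^ 2 + 2 * (Real.log p / n) * l1On Finset.univ δ ^ 2) := by
  have hK := sqMGFBound_nonneg
  have hn' : (0 : ℝ) < n := by exact_mod_cast hn
  have hlog : 0 < Real.log p := Real.log_pos (by exact_mod_cast hp)
  have hq0 : 0 < q := (div_pos hlog hn').trans_le hpq
  have hnq : Real.log p ≤ n * q := by rwa [div_le_iff₀' hn'] at hpq
  have hU := upperConst_pos hB0
  set r : ℝ := n * q / Real.log p with hr
  have hr1 : 1 ≤ r := (one_le_div hlog).2 hnq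
  -- Since r ≥ 1, this gives 2 ≤ k and r ≤ k ≤ 3r. The tuples number at most exp(2k log p) ≤
  -- exp(6nq), while k ≥ r makes 2θ/k at most 2U log p / n.
  set k : ℕ := ⌈r⌉₊ + 1 with hk
  have hk2 : 2 ≤ k := by
    have : 1 ≤ ⌈r⌉₊ := Nat.one_le_ceil_iff.2 (by linarith)
    omega
  have hkr : r ≤ k := by
    have := Nat.le_ceil r
    rw [hk]; push_cast; linarith
  have hkr3 : (k : ℝ) ≤ 3 * r := by
    have := Nat.ceil_lt_add_one (by linarith : 0 ≤ r)
    rw [hk]; push_cast; linarith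
  have hrl : r * Real.log p = n * q := by rw [hr]; field_simp
  set θ := upperConst B * q with hθ
  let bad : (Fin k → Fin p × Bool) → Set Ω := fun f =>
    {ω | (∑ l, signedBasis (f l)) ≠ 0 ∧ θ * ‖∑ l, signedBasis (f l)‖ ^ 2 ≤
      gramForm (fun i => X i ω) (idxIn (fun i => W i ω) A) (∑ l, signedBasis (f l))}
  obtain ⟨E, hE, hEP, hEb⟩ := exists_event_of_forall_le (P := P) (bad := bad)
    (b := Real.exp (-(7 * (n * q)))) (fun f => (MeasurableSet.const _).inter
      (measurableSet_le measurable_const (hB.measurable_gramForm hA _))) (fun f => by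
    by_cases hz : (∑ l, signedBasis (f l)) = 0
    · have : bad f = ∅ := by ext ω; simp [bad, hz]
      rw [this, measureReal_empty]; exact (Real.exp_pos _).le
    · refine (measureReal_mono (fun ω hω => hω.2)).trans
        ((hB.measureReal_gramForm_ge hn hA hB0 hCB (θ := θ) hq _ hz).trans (le_of_eq ?_))
      congr 1
      -- The 7 in `upperConst` makes the tail exp(−7nq): six units pay for the tuples, one remains.
      rw [hθ, upperConst]
      field_simp
      ring)
  refine ⟨E, hE, le_trans ?_ hEP, fun ω hω δ => ?_⟩
  · have h1 := mul_le_mul_of_nonneg_right (card_signedTuples_le hp k)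
      (Real.exp_pos (-(7 * (n * q)))).le
    have h2 : Real.exp (k * (2 * Real.log p)) * Real.exp (-(7 * (n * q))) ≤
        Real.exp (-(n * q)) := by
      rw [← Real.exp_add]
      apply Real.exp_le_exp.2
      have := mul_le_mul_of_nonneg_right hkr3 hlog.le
      nlinarith
    linarith
  · have h1 := gramForm_le_of_sparse (fun i => X i ω) (idxIn (fun i => W i ω) A) hk2
      (mul_pos hU hq0).le (fun f => by
        by_cases hz : (∑ l, signedBasis (f l)) = 0
        · simp [hz, gramForm]
        · by_contra hlt
          exact hEb ω hω f ⟨hz, (not_le.1 hlt).le⟩) δ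
    have h2 : 2 * (upperConst B * q) / k ≤ upperConst B * (2 * (Real.log p / n)) := by
      have hk0 : (0 : ℝ) < k := by linarith
      rw [div_le_iff₀ hk0]
      have h3 : q ≤ Real.log p / n * k := by
        rw [div_mul_eq_mul_div, le_div_iff₀ hn']
        have := mul_le_mul_of_nonneg_left hkr hlog.le
        linarith
      have := mul_le_mul_of_nonneg_left h3 hU.le
      linarith
    have h3 := mul_le_mul_of_nonneg_right h2 (sq_nonneg (l1On Finset.univ δ))
    linarith

theorem l1On_signedBasis (a : Fin p × Bool) : l1On Finset.univ (signedBasis a) = 1 := by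
  rw [l1On, Finset.sum_eq_single a.1]
  · unfold signedBasis; split_ifs <;> simp
  · intro j _ hj; simp [signedBasis, hj]
  · simp

theorem ConditionB.exists_event_le_gramForm [IsProbabilityMeasure P]
    (hB : ConditionB P X W ε ν κ φ C) (hκ : 0 < κ) (hn : 0 < n) (hp : 2 ≤ p) {A : Set ℝ}
    (hA : MeasurableSet A) {B : ℝ} (hB0 : 0 < B) (hCB : C ≤ B) :
    ∃ E : Set Ω, MeasurableSet E ∧
      1 - (Real.exp (-(lowerRate κ B / 2 * (n * ν.real A))) + Real.exp (-Real.log p)) ≤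
        P.real E ∧ ∀ ω ∈ E, ∀ δ,
      κ / 4 * ν.real A * ‖δ‖ ^ 2 -
        lowerConst κ B * (Real.log p / n) * l1On Finset.univ δ ^ 2 ≤
        gramForm (fun i => X i ω) (idxIn (fun i => W i ω) A) δ := by
  have hn' : (0 : ℝ) < n := by exact_mod_cast hn
  have hlog : 0 < Real.log p := Real.log_pos (by exact_mod_cast hp)
  have hU := upperConst_pos hB0
  have ha := lowerRate_pos hκ hB0
  set a := lowerRate κ B with hadef
  set U := upperConst B with hUdef
  set q := ν.real A with hq
  have hq0 : 0 ≤ q := measureReal_nonneg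
  have hD : lowerConst κ B = κ / a + 32 * U * (1 / a + 1) := rfl
  set r : ℝ := a * (n * q) / (4 * Real.log p) with hr
  have hrl : r * (4 * Real.log p) = a * (n * q) := by rw [hr]; field_simp
  have hr0 : 0 ≤ r := by positivity
  -- At most exp(2k log p) ≤ exp(a n q / 2) tuples, against the tail exp(−a n q) for each one.
  set k : ℕ := ⌊r⌋₊ with hk
  have hkr : (k : ℝ) ≤ r := Nat.floor_le hr0
  have hrk : r < k + 1 := Nat.lt_floor_add_one r
  -- If k = 0, then q < 4 log p / (a n), and the ℓ₁ term alone absorbs (κ/4) q ‖δ‖₂²; this uses the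
  -- summand κ/a of `lowerConst`. No exceptional event is needed.
  rcases Nat.eq_zero_or_pos k with hk0 | hk1
  · refine ⟨Set.univ, .univ, ?_, fun ω _ δ => ?_⟩
    · rw [probReal_univ]
      linarith [Real.exp_pos (-(a / 2 * (n * q))), Real.exp_pos (-Real.log p)]
    · rw [hk0] at hrk
      push_cast at hrk
      have h1 : a * (n * q) ≤ 4 * Real.log p := by nlinarith
      have h2 : κ / 4 * q ≤ κ / a * (Real.log p / n) := by
        rw [div_mul_div_comm, le_div_iff₀ (by positivity)]
        nlinarith
      have h3 : κ / a * (Real.log p / n) ≤ lowerConst κ B * (Real.log p / n) := by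
        rw [hD]
        have : 0 ≤ 32 * U * (1 / a + 1) := by positivity
        gcongr
        linarith
      have h4 : ‖δ‖ ^ 2 ≤ l1On Finset.univ δ ^ 2 :=
        pow_le_pow_left₀ (norm_nonneg _) (norm_le_l1On δ) 2
      have h5 := mul_le_mul (h2.trans h3) h4 (sq_nonneg _)
        ((by positivity : 0 ≤ κ / 4 * q).trans (h2.trans h3))
      have := gramForm_nonneg (fun i => X i ω) (idxIn (fun i => W i ω) A) δ
      linarith
  have hk1' : (1 : ℝ) ≤ k := by exact_mod_cast hk1
  obtain ⟨E₁, hE₁, hE₁P, hE₁b⟩ := exists_event_of_forall_le (P := P)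
    (bad := fun f : Fin k → Fin p × Bool =>
      {ω | gramForm (fun i => X i ω) (idxIn (fun i => W i ω) A) (∑ l, signedBasis (f l)) <
        κ / 4 * q * ‖∑ l, signedBasis (f l)‖ ^ 2})
    (fun f => measurableSet_lt (hB.measurable_gramForm hA _) measurable_const)
    (fun f => hB.measureReal_gramForm_lt hκ hn hA hB0 hCB _)
  -- The upper bound, applied to signed basis vectors, supplies the constant M required by
  -- `gramForm_ge_of_sparse`; it needs a mass parameter of at least log p / n.
  set q' := max q (Real.log p / n) with hq'
  obtain ⟨E₂, hE₂, hE₂P, hE₂b⟩ := hB.exists_event_gramForm_le hn hp hA hB0 hCB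
    (le_max_left q (Real.log p / n)) (le_max_right q (Real.log p / n))
  have hP₁ : 1 - Real.exp (-(a / 2 * (n * q))) ≤ P.real E₁ := by
    refine le_trans ?_ hE₁P
    have h1 := mul_le_mul_of_nonneg_right (card_signedTuples_le hp k)
      (Real.exp_pos (-(n * q * a))).le
    have h2 : Real.exp (k * (2 * Real.log p)) * Real.exp (-(n * q * a)) ≤
        Real.exp (-(a / 2 * (n * q))) := by
      rw [← Real.exp_add]
      apply Real.exp_le_exp.2
      have := mul_le_mul_of_nonneg_right hkr hlog.le
      nlinarith
    linarith
  have hP₂ : 1 - Real.exp (-Real.log p) ≤ P.real E₂ := by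
    refine le_trans ?_ hE₂P
    have : Real.log p ≤ n * q' := by
      have := le_max_right q (Real.log p / n)
      rwa [div_le_iff₀' hn'] at this
    have := Real.exp_le_exp.2 (neg_le_neg this)
    linarith
  obtain ⟨E, hE, hEP, hEb⟩ := exists_event_inter ⟨E₁, hE₁, hP₁, hE₁b⟩ ⟨E₂, hE₂, hP₂, hE₂b⟩
  refine ⟨E, hE, hEP, fun ω hω δ => ?_⟩
  obtain ⟨h1, h2⟩ := hEb ω hω
  have h3 := gramForm_ge_of_sparse (fun i => X i ω) (idxIn (fun i => W i ω) A) hk1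
    (by positivity : 0 ≤ κ / 4 * q) (fun f => not_lt.1 (h1 f))
    (M := U * (q' + 2 * (Real.log p / n))) (fun b => by
      have := h2 (signedBasis b)
      rw [norm_signedBasis, l1On_signedBasis] at this
      simpa using this) δ
  have hL0 : 0 < Real.log p / n := by positivity
  have h4 : Real.log p / n ≤ a / 4 * q := by
    rw [div_le_iff₀ hn']
    nlinarith
  have h5 : q' ≤ q + Real.log p / n := max_le (by linarith) (by linarith)
  -- From r < k + 1 ≤ 2k.
  have hqk : q ≤ 8 / a * (Real.log p / n) * k := by
    rw [div_mul_div_comm, div_mul_eq_mul_div, le_div_iff₀ (by positivity)]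
    nlinarith
  have h6 : U * (q' + 2 * (Real.log p / n)) / k ≤ lowerConst κ B * (Real.log p / n) := by
    rw [div_le_iff₀ (by linarith), hD]
    have h7 : q' + 2 * (Real.log p / n) ≤ (1 / a + 1) * (32 * (Real.log p / n) * k) := by
      have h8 : Real.log p / n ≤ Real.log p / n * k := le_mul_of_one_le_right hL0.le hk1'
      have h9 : q ≤ 8 * (1 / a * ((Real.log p / n) * k)) := by
        calc q ≤ _ := hqk
          _ = _ := by ring
      have h10 : 0 ≤ 1 / a * ((Real.log p / n) * k) := by positivity
      calc _ ≤ 32 * (1 / a * ((Real.log p / n) * k)) + 32 * ((Real.log p / n) * k) := by linarith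
        _ = _ := by ring
    have h11 := mul_le_mul_of_nonneg_left h7 hU.le
    have h12 : 0 ≤ κ / a * (Real.log p / n) * k := by positivity
    calc _ ≤ _ := h11
      _ ≤ κ / a * (Real.log p / n) * k + U * ((1 / a + 1) * (32 * (Real.log p / n) * k)) := by
        linarith
      _ = _ := by ring
  have h13 := mul_le_mul_of_nonneg_right h6 (sq_nonneg (l1On Finset.univ δ))
  linarith

end ChangePoint

namespace ChangePoint

/-! ### Extremal sets between `τ₀` and a varying threshold -/

section Order

theorem Phi_nonneg {ν : Measure ℝ} (t : WithBot ℝ) : 0 ≤ Phi ν t := measureReal_nonneg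

variable {ν : Measure ℝ} [IsProbabilityMeasure ν]

theorem measurableSet_exists_le (T : Set (WithBot ℝ)) :
    MeasurableSet {w : ℝ | ∃ t ∈ T, (w : WithBot ℝ) ≤ t} := by
  have h : IsLowerSet {w : ℝ | ∃ t ∈ T, (w : WithBot ℝ) ≤ t} := by
    rintro a b hba ⟨t, ht, h⟩
    exact ⟨t, ht, (WithBot.coe_le_coe.2 hba).trans h⟩
  exact h.ordConnected.measurableSet

theorem measurableSet_exists_lt (T : Set (WithBot ℝ)) :
    MeasurableSet {w : ℝ | ∃ t ∈ T, t < (w : WithBot ℝ)} := by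
  have h : IsUpperSet {w : ℝ | ∃ t ∈ T, t < (w : WithBot ℝ)} := by
    rintro a b hab ⟨t, ht, h⟩
    exact ⟨t, ht, h.trans_le (WithBot.coe_le_coe.2 hab)⟩
  exact h.ordConnected.measurableSet

theorem measurableSet_coe_le (τ : WithBot ℝ) : MeasurableSet {w : ℝ | (w : WithBot ℝ) ≤ τ} := by
  simpa using measurableSet_exists_le {τ}

theorem measurableSet_lt_coe (τ : WithBot ℝ) : MeasurableSet {w : ℝ | τ < (w : WithBot ℝ)} := by
  simpa using measurableSet_exists_lt {τ}

theorem measureReal_lt_coe (τ : WithBot ℝ) : ν.real {w : ℝ | τ < (w : WithBot ℝ)} = 1 - Phi ν τ := by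
  rw [Phi, ← probReal_compl_eq_one_sub (measurableSet_coe_le τ)]
  congr 1
  ext w
  simp

theorem measureReal_le_of_isCompact {A : Set ℝ} (hA : MeasurableSet A) {u : ℝ} (hu : 0 ≤ u)
    (h : ∀ K ⊆ A, IsCompact K → K.Nonempty → ν.real K ≤ u) : ν.real A ≤ u := by
  by_contra hlt
  rw [not_le, ← ENNReal.ofReal_lt_ofReal_iff_of_nonneg hu, ofReal_measureReal] at hlt
  obtain ⟨K, hKA, hK, hlt⟩ := hA.exists_lt_isCompact hlt
  rcases K.eq_empty_or_nonempty with rfl | hne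
  · simp at hlt
  · have := h K hKA hK hne
    rw [← ofReal_measureReal (μ := ν) (s := K)] at hlt
    exact absurd (ENNReal.ofReal_le_ofReal this) (not_le.2 hlt)

/-- The union over `T` may be uncountable and its supremum not attained. A compact subset has a
greatest point, so a single t ∈ T already covers it; inner regularity does the rest. -/
theorem measureReal_exists_le_le {T : Set (WithBot ℝ)} {u : ℝ} (hu : 0 ≤ u)
    (h : ∀ t ∈ T, Phi ν t ≤ u) : ν.real {w : ℝ | ∃ t ∈ T, (w : WithBot ℝ) ≤ t} ≤ u := by
  refine measureReal_le_of_isCompact (measurableSet_exists_le T) hu fun K hKA hK hne => ?_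
  obtain ⟨k, hkK, hk⟩ := hK.exists_isGreatest hne
  obtain ⟨t, ht, hkt⟩ := hKA hkK
  exact (measureReal_mono fun w hw => (WithBot.coe_le_coe.2 (hk hw)).trans hkt).trans (h t ht)

theorem measureReal_exists_lt_le {T : Set (WithBot ℝ)} {u : ℝ} (hu : 0 ≤ u)
    (h : ∀ t ∈ T, 1 - Phi ν t ≤ u) : ν.real {w : ℝ | ∃ t ∈ T, t < (w : WithBot ℝ)} ≤ u := by
  refine measureReal_le_of_isCompact (measurableSet_exists_lt T) hu fun K hKA hK hne => ?_
  obtain ⟨k, hkK, hk⟩ := hK.exists_isLeast hne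
  obtain ⟨t, ht, hkt⟩ := hKA hkK
  have h1 : ν.real K ≤ ν.real {w : ℝ | t < (w : WithBot ℝ)} :=
    measureReal_mono fun w hw => hkt.trans_le (WithBot.coe_le_coe.2 (hk hw))
  rw [measureReal_lt_coe] at h1
  exact h1.trans (h t ht)

theorem Phi_le_one (t : WithBot ℝ) : Phi ν t ≤ 1 := measureReal_le_one

/-- The values between `τ₀` and `t`, as in `idxBetween`. -/
def between (τ₀ t : WithBot ℝ) : Set ℝ :=
  {w | (τ₀ < (w : WithBot ℝ) ∧ (w : WithBot ℝ) ≤ t) ∨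
    (t < (w : WithBot ℝ) ∧ (w : WithBot ℝ) ≤ τ₀)}

theorem idxBetween_eq {n : ℕ} (w : Fin n → ℝ) (τ₀ t : WithBot ℝ) :
    idxBetween w τ₀ t = idxIn w (between τ₀ t) := by
  ext i
  simp only [idxBetween, idxIn, Finset.mem_filter]
  rfl

theorem idxIn_mono {n : ℕ} (w : Fin n → ℝ) {A A' : Set ℝ} (h : A ⊆ A') :
    idxIn w A ⊆ idxIn w A' := by
  intro i
  simp only [idxIn, Finset.mem_filter, Finset.mem_univ, true_and]
  exact fun hi => h hi

/-- The union of all the sets between τ₀ and t splits into a part above τ₀ and a part below. Each is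
a difference of nested half-lines of mass at most u, hence 2u. -/
theorem exists_superset_between (τ₀ : WithBot ℝ) {u : ℝ} (hu : 0 ≤ u) :
    ∃ A : Set ℝ, MeasurableSet A ∧ ν.real A ≤ 2 * u ∧
      ∀ t ∈ Nbhd ν τ₀ u, between τ₀ t ⊆ A := by
  have hT : ∀ t ∈ Nbhd ν τ₀ u, |Phi ν t - Phi ν τ₀| ≤ u := fun t ht => ht
  have hτ₀ : τ₀ ∈ Nbhd ν τ₀ u := by
    change |Phi ν τ₀ - Phi ν τ₀| ≤ u
    simpa using hu
  have h0 := Phi_nonneg (ν := ν) τ₀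
  have h1 := Phi_le_one (ν := ν) τ₀
  set T := Nbhd ν τ₀ u
  refine ⟨({w : ℝ | ∃ t ∈ T, (w : WithBot ℝ) ≤ t} \ {w : ℝ | (w : WithBot ℝ) ≤ τ₀}) ∪
    ({w : ℝ | ∃ t ∈ T, t < (w : WithBot ℝ)} \ {w : ℝ | τ₀ < (w : WithBot ℝ)}),
    ((measurableSet_exists_le T).diff (measurableSet_coe_le τ₀)).union
      ((measurableSet_exists_lt T).diff (measurableSet_lt_coe τ₀)), ?_, fun t ht w hw => ?_⟩
  · refine (measureReal_union_le _ _).trans ?_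
    have hle : {w : ℝ | (w : WithBot ℝ) ≤ τ₀} ⊆ {w : ℝ | ∃ t ∈ T, (w : WithBot ℝ) ≤ t} :=
      fun w hw => ⟨τ₀, hτ₀, hw⟩
    have hlt : {w : ℝ | τ₀ < (w : WithBot ℝ)} ⊆ {w : ℝ | ∃ t ∈ T, t < (w : WithBot ℝ)} :=
      fun w hw => ⟨τ₀, hτ₀, hw⟩
    rw [measureReal_sdiff hle (measurableSet_coe_le τ₀),
      measureReal_sdiff hlt (measurableSet_lt_coe τ₀), measureReal_lt_coe]
    have h2 := measureReal_exists_le_le (ν := ν) (T := T) (u := Phi ν τ₀ + u) (by linarith)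
      fun t ht => by linarith [(abs_le.1 (hT t ht)).2]
    have h3 := measureReal_exists_lt_le (ν := ν) (T := T) (u := 1 - Phi ν τ₀ + u) (by linarith)
      fun t ht => by linarith [(abs_le.1 (hT t ht)).1]
    have h4 : ν.real {w : ℝ | (w : WithBot ℝ) ≤ τ₀} = Phi ν τ₀ := rfl
    linarith
  · rcases hw with ⟨hw1, hw2⟩ | ⟨hw1, hw2⟩
    · exact Or.inl ⟨⟨t, ht, hw2⟩, not_le.2 hw1⟩
    · exact Or.inr ⟨⟨t, ht, hw1⟩, not_lt.2 hw2⟩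

/-- The witness is the common part of all the intervals (τ₀, t]. What is removed from the half-line
above τ₀ has mass at most 1 − Φ(τ₀) − v; nonemptiness makes this bound nonnegative. -/
theorem exists_subset_between_right (τ₀ : WithBot ℝ) {v : ℝ}
    (hne : {t : WithBot ℝ | v ≤ Phi ν t - Phi ν τ₀}.Nonempty) :
    ∃ A : Set ℝ, MeasurableSet A ∧ v ≤ ν.real A ∧
      ∀ t ∈ {t : WithBot ℝ | v ≤ Phi ν t - Phi ν τ₀}, A ⊆ between τ₀ t := by
  set T := {t : WithBot ℝ | v ≤ Phi ν t - Phi ν τ₀}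
  have hT : ∀ t ∈ T, v ≤ Phi ν t - Phi ν τ₀ := fun t ht => ht
  refine ⟨{w : ℝ | τ₀ < (w : WithBot ℝ)} \ {w : ℝ | ∃ t ∈ T, t < (w : WithBot ℝ)},
    (measurableSet_lt_coe τ₀).diff (measurableSet_exists_lt T), ?_, fun t ht w hw => ?_⟩
  · obtain ⟨t₁, ht₁⟩ := hne
    have h2 := measureReal_exists_lt_le (ν := ν) (T := T) (u := 1 - Phi ν τ₀ - v)
      (by linarith [hT t₁ ht₁, Phi_le_one (ν := ν) t₁]) fun t ht => by linarith [hT t ht]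
    have h3 := le_measureReal_sdiff (μ := ν) (s₁ := {w : ℝ | τ₀ < (w : WithBot ℝ)})
      (s₂ := {w : ℝ | ∃ t ∈ T, t < (w : WithBot ℝ)})
    rw [measureReal_lt_coe] at h3
    linarith
  · exact Or.inl ⟨hw.1, not_lt.1 fun h => hw.2 ⟨t, ht, h⟩⟩

theorem exists_subset_between_left (τ₀ : WithBot ℝ) {v : ℝ}
    (hne : {t : WithBot ℝ | v ≤ Phi ν τ₀ - Phi ν t}.Nonempty) :
    ∃ A : Set ℝ, MeasurableSet A ∧ v ≤ ν.real A ∧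
      ∀ t ∈ {t : WithBot ℝ | v ≤ Phi ν τ₀ - Phi ν t}, A ⊆ between τ₀ t := by
  set T := {t : WithBot ℝ | v ≤ Phi ν τ₀ - Phi ν t}
  have hT : ∀ t ∈ T, v ≤ Phi ν τ₀ - Phi ν t := fun t ht => ht
  refine ⟨{w : ℝ | (w : WithBot ℝ) ≤ τ₀} \ {w : ℝ | ∃ t ∈ T, (w : WithBot ℝ) ≤ t},
    (measurableSet_coe_le τ₀).diff (measurableSet_exists_le T), ?_, fun t ht w hw => ?_⟩
  · obtain ⟨t₁, ht₁⟩ := hne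
    have h2 := measureReal_exists_le_le (ν := ν) (T := T) (u := Phi ν τ₀ - v)
      (by linarith [hT t₁ ht₁, Phi_nonneg (ν := ν) t₁]) fun t ht => by linarith [hT t ht]
    have h3 := le_measureReal_sdiff (μ := ν) (s₁ := {w : ℝ | (w : WithBot ℝ) ≤ τ₀})
      (s₂ := {w : ℝ | ∃ t ∈ T, (w : WithBot ℝ) ≤ t})
    have h4 : ν.real {w : ℝ | (w : WithBot ℝ) ≤ τ₀} = Phi ν τ₀ := rfl
    linarith
  · exact Or.inr ⟨not_le.1 fun h => hw.2 ⟨t, ht, h⟩, hw.1⟩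

end Order

/-! ### The restricted eigenvalue conditions for a fixed sample size -/

variable {n p : ℕ} {Ω : Type*} [MeasurableSpace Ω] {P : Measure Ω}
  {X : Fin n → Ω → EuclideanSpace ℝ (Fin p)} {W ε : Fin n → Ω → ℝ} {ν : Measure ℝ}
  {κ φ C : ℝ}

/-- On the cone the ℓ₁ loss is at most 16 D (s log p / n)‖δ‖². The smallness hypothesis with 128
makes it at most (κ/8) ν(A)‖δ‖², half of the main term. -/
theorem ConditionB.exists_event_coneA [IsProbabilityMeasure P]
    (hB : ConditionB P X W ε ν κ φ C) (hκ : 0 < κ) (hn : 0 < n) (hp : 2 ≤ p) {A : Set ℝ}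
    (hA : MeasurableSet A) {B : ℝ} (hB0 : 0 < B) (hCB : C ≤ B) {s : ℕ} (hs : 1 ≤ s)
    {S : Finset (Fin p)} (hS : S.card ≤ s) {c₂ : ℝ} (hc₂ : c₂ ≤ 1)
    (hc₂' : c₂ ≤ lowerRate κ B / 2) (hq₁ : s * Real.log p / n ≤ ν.real A)
    (hq₂ : s * Real.log p / n ≤ κ / (128 * lowerConst κ B) * ν.real A) :
    ∃ E : Set Ω, MeasurableSet E ∧ 1 - 2 * Real.exp (-c₂ * Real.log p) ≤ P.real E ∧
      ∀ ω ∈ E, ∀ δ ∈ coneA S, 1 / 8 * κ * ν.real A * ‖δ‖ ^ 2 ≤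
        gramForm (fun i => X i ω) (idxIn (fun i => W i ω) A) δ := by
  obtain ⟨E, hE, hEP, hEb⟩ := hB.exists_event_le_gramForm hκ hn hp hA hB0 hCB
  have hn' : (0 : ℝ) < n := by exact_mod_cast hn
  have hs' : (1 : ℝ) ≤ s := by exact_mod_cast hs
  have hlog : 0 < Real.log p := Real.log_pos (by exact_mod_cast hp)
  have hD := lowerConst_pos hκ hB0
  refine ⟨E, hE, le_trans ?_ hEP, fun ω hω δ hδ => ?_⟩
  · have h1 : Real.log p ≤ n * ν.real A := by
      rw [div_le_iff₀' hn'] at hq₁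
      nlinarith
    have h2 : Real.exp (-Real.log p) ≤ Real.exp (-c₂ * Real.log p) :=
      Real.exp_le_exp.2 (by nlinarith)
    have h3 : Real.exp (-(lowerRate κ B / 2 * (n * ν.real A))) ≤
        Real.exp (-c₂ * Real.log p) := by
      apply Real.exp_le_exp.2
      have h4 := mul_le_mul_of_nonneg_left h1 (half_pos (lowerRate_pos hκ hB0)).le
      have h5 := mul_le_mul_of_nonneg_right hc₂' hlog.le
      linarith
    linarith
  · have h1 := hEb ω hω δ
    have h2 := l1_sq_le_of_mem_coneA hS hδ
    have h3 := mul_le_mul_of_nonneg_left h2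
      (by positivity : 0 ≤ lowerConst κ B * (Real.log p / n))
    have h4 : lowerConst κ B * (s * Real.log p / n) ≤ κ / 128 * ν.real A := by
      have := mul_le_mul_of_nonneg_left hq₂ hD.le
      calc _ ≤ _ := this
        _ = _ := by field_simp
    have h5 := mul_le_mul_of_nonneg_right h4 (sq_nonneg ‖δ‖)
    have h6 : lowerConst κ B * (Real.log p / n) * (16 * (s * ‖δ‖ ^ 2)) =
        16 * (lowerConst κ B * (s * Real.log p / n) * ‖δ‖ ^ 2) := by ring
    linarith

theorem ConditionB.exists_event_near [IsProbabilityMeasure P] [IsProbabilityMeasure ν]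
    (hB : ConditionB P X W ε ν κ φ C) (hn : 0 < n) (hp : 2 ≤ p)
    {B : ℝ} (hB0 : 0 < B) (hCB : C ≤ B) {s : ℕ} (hs : 1 ≤ s)
    {S : Finset (Fin p)} (hS : S.card ≤ s) {c₂ : ℝ} (hc₂ : c₂ ≤ 1) (τ₀ : WithBot ℝ) {u : ℝ}
    (hu : 0 ≤ u) :
    ∃ E : Set Ω, MeasurableSet E ∧ 1 - Real.exp (-c₂ * Real.log p) ≤ P.real E ∧
      ∀ ω ∈ E, ∀ t ∈ Nbhd ν τ₀ u, ∀ δ ∈ coneA S,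
        gramForm (fun i => X i ω) (idxBetween (fun i => W i ω) τ₀ t) δ ≤
          34 * upperConst B * ‖δ‖ ^ 2 * max (s * Real.log p / n) u := by
  obtain ⟨A, hA, hAu, hAs⟩ := exists_superset_between (ν := ν) τ₀ hu
  have hn' : (0 : ℝ) < n := by exact_mod_cast hn
  have hs' : (1 : ℝ) ≤ s := by exact_mod_cast hs
  have hlog : 0 < Real.log p := Real.log_pos (by exact_mod_cast hp)
  have hU := upperConst_pos hB0
  set m := max (s * Real.log p / n) u with hm
  have hm1 : s * Real.log p / n ≤ m := le_max_left _ _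
  have hm2 : u ≤ m := le_max_right _ _
  have hL : Real.log p / n ≤ s * Real.log p / n := by
    gcongr; exact le_mul_of_one_le_left hlog.le hs'
  have hL0 : 0 < Real.log p / n := by positivity
  -- The parameter 2m dominates both the mass 2u and log p / n. With the cone bound the constant is
  -- 2 + 2·16 = 34.
  obtain ⟨E, hE, hEP, hEb⟩ := hB.exists_event_gramForm_le hn hp hA hB0 hCB (q := 2 * m)
    (by linarith) (by linarith)
  refine ⟨E, hE, le_trans ?_ hEP, fun ω hω t ht δ hδ => ?_⟩
  · have h1 : Real.log p ≤ n * (2 * m) := by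
      rw [← div_le_iff₀' hn']; linarith
    have : Real.exp (-(n * (2 * m))) ≤ Real.exp (-c₂ * Real.log p) :=
      Real.exp_le_exp.2 (by nlinarith)
    linarith
  · rw [idxBetween_eq]
    refine (gramForm_mono _ (idxIn_mono _ (hAs t ht)) δ).trans ((hEb ω hω δ).trans ?_)
    have h2 := mul_le_mul_of_nonneg_left (l1_sq_le_of_mem_coneA hS hδ) hL0.le
    have h3 : Real.log p / n * (16 * (s * ‖δ‖ ^ 2)) =
      16 * (s * Real.log p / n * ‖δ‖ ^ 2) := by ring
    have h4 := mul_le_mul_of_nonneg_right hm1 (sq_nonneg ‖δ‖)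
    calc upperConst B * (2 * m * ‖δ‖ ^ 2 + 2 * (Real.log p / n) * l1On Finset.univ δ ^ 2)
        ≤ upperConst B * (34 * (m * ‖δ‖ ^ 2)) := by gcongr; linarith
      _ = _ := by ring

/-- One set `A` inside every interval serves all t ∈ T. Its mass is at least v ≥ c log p / n, which
turns exp(−(a/2) n ν(A)), with a = `lowerRate κ B`, into a power of p; this is how c enters c₂. -/
theorem ConditionB.exists_event_far [IsProbabilityMeasure P]
    (hB : ConditionB P X W ε ν κ φ C) (hκ : 0 < κ) (hn : 0 < n) (hp : 2 ≤ p)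
    {B : ℝ} (hB0 : 0 < B) (hCB : C ≤ B) {s : ℕ} {β₀ γ₀ : EuclideanSpace ℝ (Fin p)}
    (hS : (suppSet β₀ γ₀).card ≤ s) {c c₂ : ℝ} (hc₂ : c₂ ≤ 1)
    (hc₂' : c₂ ≤ lowerRate κ B / 2 * c) (τ₀ : WithBot ℝ) {v : ℝ}
    (hv : c * Real.log p / n ≤ v) (T : Set (WithBot ℝ))
    (hT : T.Nonempty → ∃ A : Set ℝ, MeasurableSet A ∧ v ≤ ν.real A ∧
      ∀ t ∈ T, A ⊆ between τ₀ t) :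
    ∃ E : Set Ω, MeasurableSet E ∧ 1 - 2 * Real.exp (-c₂ * Real.log p) ≤ P.real E ∧
      ∀ ω ∈ E, ∀ t ∈ T, ∀ δ ∈ coneA₂ β₀ γ₀,
        κ / 4 * v * ‖δ‖ ^ 2 - 32 * lowerConst κ B * (s * Real.log p / n) *
            (‖δ‖ ^ 2 + ‖β₀ - γ₀‖ ^ 2) ≤
          gramForm (fun i => X i ω) (idxBetween (fun i => W i ω) τ₀ t) δ := by
  rcases T.eq_empty_or_nonempty with rfl | hne
  · refine ⟨Set.univ, .univ, ?_, fun ω _ t ht => absurd ht (Set.notMem_empty t)⟩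
    rw [probReal_univ]
    linarith [Real.exp_pos (-c₂ * Real.log p)]
  obtain ⟨A, hA, hvA, hAs⟩ := hT hne
  obtain ⟨E, hE, hEP, hEb⟩ := hB.exists_event_le_gramForm hκ hn hp hA hB0 hCB
  have hn' : (0 : ℝ) < n := by exact_mod_cast hn
  have hlog : 0 < Real.log p := Real.log_pos (by exact_mod_cast hp)
  have hD := lowerConst_pos hκ hB0
  refine ⟨E, hE, le_trans ?_ hEP, fun ω hω t ht δ hδ => ?_⟩
  · have h1 : c * Real.log p ≤ n * ν.real A := by
      rw [← div_le_iff₀' hn']; linarith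
    have h2 : Real.exp (-Real.log p) ≤ Real.exp (-c₂ * Real.log p) :=
      Real.exp_le_exp.2 (by nlinarith)
    have h3 : Real.exp (-(lowerRate κ B / 2 * (n * ν.real A))) ≤
        Real.exp (-c₂ * Real.log p) := by
      apply Real.exp_le_exp.2
      have h4 := mul_le_mul_of_nonneg_left h1 (half_pos (lowerRate_pos hκ hB0)).le
      have h5 := mul_le_mul_of_nonneg_right hc₂' hlog.le
      linarith
    linarith
  · rw [idxBetween_eq]
    refine le_trans ?_ (gramForm_mono _ (idxIn_mono _ (hAs t ht)) δ)
    refine le_trans ?_ (hEb ω hω δ)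
    have h3 := mul_le_mul_of_nonneg_left (l1_sq_le_of_mem_coneA₂ hS hδ)
      (by positivity : 0 ≤ lowerConst κ B * (Real.log p / n))
    have h4 : lowerConst κ B * (Real.log p / n) * (32 * (s * (‖δ‖ ^ 2 + ‖β₀ - γ₀‖ ^ 2))) =
      32 * lowerConst κ B * (s * Real.log p / n) * (‖δ‖ ^ 2 + ‖β₀ - γ₀‖ ^ 2) := by ring
    have h5 : κ / 4 * v * ‖δ‖ ^ 2 ≤ κ / 4 * ν.real A * ‖δ‖ ^ 2 := by gcongr
    linarith

theorem idxLe_eq (w : Fin n → ℝ) (τ : ℝ) :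
    idxLe w τ = idxIn w {x : ℝ | (x : WithBot ℝ) ≤ (τ : WithBot ℝ)} := by
  ext i; simp [idxLe, idxIn]

theorem idxGt_eq (w : Fin n → ℝ) (τ : ℝ) :
    idxGt w τ = idxIn w {x : ℝ | (τ : WithBot ℝ) < (x : WithBot ℝ)} := by
  ext i; simp [idxGt, idxIn]

end ChangePoint

/-! ### Choice of constants and assembly of the events -/

theorem lemmal3 :
    ∃ cu : ℝ, 0 < cu ∧
    ∀ κ φ C : ℝ, 0 < κ →
    ∃ c₃ c₄ c₅ : ℝ, 0 < c₃ ∧ 0 < c₄ ∧ 0 < c₅ ∧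
    ∀ c : ℝ, 0 < c →
    ∃ c₁ c₂ : ℝ, 0 < c₁ ∧ 0 < c₂ ∧
    ∀ (p s : ℕ → ℕ) (β₀ γ₀ : (n : ℕ) → EuclideanSpace ℝ (Fin (p n))) (l : ℕ → ℝ)
      (Ω : ℕ → Type*) [∀ n, MeasurableSpace (Ω n)]
      (P : (n : ℕ) → Measure (Ω n)) [∀ n, IsProbabilityMeasure (P n)]
      (X : (n : ℕ) → Fin n → Ω n → EuclideanSpace ℝ (Fin (p n)))
      (W ε : (n : ℕ) → Fin n → Ω n → ℝ)
      (ν : ℕ → Measure ℝ) [∀ n, IsProbabilityMeasure (ν n)]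
      (τ₀ : ℕ → WithBot ℝ) (τ : ℕ → ℝ) (u v : ℕ → ℝ),
      ChangePoint.ConditionA p s β₀ γ₀ l →
      (∀ n, ChangePoint.ConditionB (P n) (X n) (W n) (ε n) (ν n) κ φ C) →
      (∀ n, 0 ≤ u n) →
      (∀ n, 0 ≤ v n) →
      (∀ n, c * Real.log (p n) / n ≤ v n) →
      (∀ᶠ n in atTop, 0 < ChangePoint.PhiMin (ν n) (τ n)) →
      Tendsto (fun n : ℕ => (ChangePoint.PhiMin (ν n) (τ n))⁻¹ *
        ((s n : ℝ) * Real.log (p n) / n)) atTop (𝓝 0) →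
      ∃ N : ℕ, ∀ n ≥ N, ∃ E : Set (Ω n), MeasurableSet E ∧
        1 - c₁ * Real.exp (-c₂ * Real.log (p n)) ≤ (P n).real E ∧
        ∀ ω ∈ E,
          (∀ δ ∈ ChangePoint.coneA (ChangePoint.suppSet (β₀ n) (γ₀ n)),
            cu * κ * ChangePoint.Phi (ν n) (τ n) * ‖δ‖ ^ 2 ≤
              ChangePoint.gramForm (fun i => X n i ω)
                (ChangePoint.idxLe (fun i => W n i ω) (τ n)) δ) ∧
          (∀ δ ∈ ChangePoint.coneA (ChangePoint.suppSet (β₀ n) (γ₀ n)),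
            cu * κ * (1 - ChangePoint.Phi (ν n) (τ n)) * ‖δ‖ ^ 2 ≤
              ChangePoint.gramForm (fun i => X n i ω)
                (ChangePoint.idxGt (fun i => W n i ω) (τ n)) δ) ∧
          (∀ t ∈ ChangePoint.Nbhd (ν n) (τ₀ n) (u n),
            ∀ δ ∈ ChangePoint.coneA (ChangePoint.suppSet (β₀ n) (γ₀ n)),
              ChangePoint.gramForm (fun i => X n i ω)
                (ChangePoint.idxBetween (fun i => W n i ω) (τ₀ n) t) δ ≤
              c₃ * ‖δ‖ ^ 2 * max ((s n : ℝ) * Real.log (p n) / n) (u n)) ∧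
          (∀ t : ℝ, v n ≤ ChangePoint.PhiStar (ν n) (τ₀ n) t →
            ∀ δ ∈ ChangePoint.coneA₂ (β₀ n) (γ₀ n),
              c₄ * v n * ‖δ‖ ^ 2 -
                c₅ * ((s n : ℝ) * Real.log (p n) / n) * (‖δ‖ ^ 2 + ‖β₀ n - γ₀ n‖ ^ 2) ≤
              ChangePoint.gramForm (fun i => X n i ω)
                (ChangePoint.idxBetween (fun i => W n i ω) (τ₀ n) (t : WithBot ℝ)) δ) := by
  refine ⟨1 / 8, by norm_num, fun κ φ C hκ => ?_⟩
  -- Keeps the variance bound positive without a sign condition on `C`.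
  set B := max C 1
  have hB0 : 0 < B := lt_max_of_lt_right one_pos
  have hCB : C ≤ B := le_max_left _ _
  have hU := ChangePoint.upperConst_pos hB0
  have hD := ChangePoint.lowerConst_pos hκ hB0
  have ha := ChangePoint.lowerRate_pos hκ hB0
  set a := ChangePoint.lowerRate κ B
  set D := ChangePoint.lowerConst κ B
  refine ⟨34 * ChangePoint.upperConst B, κ / 4, 32 * D, by positivity, by positivity,
    by positivity, fun c hc => ?_⟩
  set c₂ := min 1 (min (a / 2) (a / 2 * c))
  have hc₂ : c₂ ≤ 1 := min_le_left _ _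
  have hc₂a : c₂ ≤ a / 2 := (min_le_right _ _).trans (min_le_left _ _)
  have hc₂c : c₂ ≤ a / 2 * c := (min_le_right _ _).trans (min_le_right _ _)
  -- 9 = 2 + 2 + 1 + 2 + 2: the two sides of τ, the near thresholds, and the far thresholds to the
  -- right and left of τ₀.
  refine ⟨9, c₂, by norm_num, lt_min one_pos (lt_min (by positivity) (by positivity)), ?_⟩
  intro p s β₀ γ₀ l Ω _ P _ X W ε ν _ τ₀ τ u v hA hB hu hv hcv hmin hlim
  have hη : 0 < min 1 (κ / (128 * D)) := lt_min one_pos (by positivity)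
  obtain ⟨N, hN⟩ := eventually_atTop.1 (hmin.and (hlim.eventually (gt_mem_nhds hη)))
  refine ⟨max N 1, fun n hnN => ?_⟩
  obtain ⟨hm, hr⟩ := hN n ((le_max_left _ _).trans hnN)
  have hn : 0 < n := (le_max_right _ _).trans hnN
  -- For p ≤ 1 the logarithm is 0, so the required probability 1 − 9 is negative and the empty event
  -- suffices.
  rcases lt_or_ge (p n) 2 with hp | hp
  · refine ⟨∅, .empty, ?_, fun ω hω => absurd hω (Set.notMem_empty ω)⟩
    have : Real.log (p n) = 0 := by interval_cases p n <;> simp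
    rw [this]
    simp
  rw [inv_mul_lt_iff₀ hm] at hr
  have hlog : 0 < Real.log (p n) := Real.log_pos (by exact_mod_cast hp)
  have hn' : (0 : ℝ) < n := by exact_mod_cast hn
  have hv0 : 0 < v n := (by positivity : 0 < c * Real.log (p n) / n).trans_le (hcv n)
  have hr' : ∀ q, ChangePoint.PhiMin (ν n) (τ n) ≤ q →
      (s n : ℝ) * Real.log (p n) / n ≤ q ∧
      (s n : ℝ) * Real.log (p n) / n ≤ κ / (128 * D) * q := fun q hq => by
    refine ⟨hr.le.trans ?_, hr.le.trans ?_⟩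
    · calc _ ≤ ChangePoint.PhiMin (ν n) (τ n) * 1 := by gcongr; exact min_le_left _ _
        _ ≤ q := by rwa [mul_one]
    · rw [mul_comm]
      exact mul_le_mul (min_le_right _ _) hq hm.le (by positivity)
  have hgt := ChangePoint.measureReal_lt_coe (ν := ν n) (τ n)
  have h₁ := (hB n).exists_event_coneA hκ hn hp
    (ChangePoint.measurableSet_coe_le (τ n)) hB0 hCB (hA.one_le_s n) (hA.card_le n) hc₂ hc₂a
    (hr' _ (min_le_left _ _)).1 (hr' _ (min_le_left _ _)).2
  have h₂ := (hB n).exists_event_coneA hκ hn hp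
    (ChangePoint.measurableSet_lt_coe (τ n)) hB0 hCB (hA.one_le_s n) (hA.card_le n) hc₂ hc₂a
    (hr' _ ((min_le_right _ _).trans hgt.ge)).1 (hr' _ ((min_le_right _ _).trans hgt.ge)).2
  have h₃ := (hB n).exists_event_near hn hp hB0 hCB (hA.one_le_s n) (hA.card_le n) hc₂
    (τ₀ n) (hu n)
  have h₄ := (hB n).exists_event_far hκ hn hp hB0 hCB (hA.card_le n) hc₂ hc₂c (τ₀ n) (hcv n) _
    (ChangePoint.exists_subset_between_right (τ₀ n))
  have h₅ := (hB n).exists_event_far hκ hn hp hB0 hCB (hA.card_le n) hc₂ hc₂c (τ₀ n) (hcv n) _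
    (ChangePoint.exists_subset_between_left (τ₀ n))
  obtain ⟨E, hE, hEP, hEb⟩ := ChangePoint.exists_event_inter h₁ (ChangePoint.exists_event_inter h₂
    (ChangePoint.exists_event_inter h₃ (ChangePoint.exists_event_inter h₄ h₅)))
  refine ⟨E, hE, by linarith, fun ω hω => ?_⟩
  obtain ⟨g₁, g₂, g₃, g₄, g₅⟩ := hEb ω hω
  refine ⟨fun δ hδ => ?_, fun δ hδ => ?_, g₃, fun t ht δ hδ => ?_⟩
  · rw [ChangePoint.idxLe_eq]
    exact g₁ δ hδ
  · rw [ChangePoint.idxGt_eq, ← hgt]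
    exact g₂ δ hδ
  -- The sign of Φ(t) − Φ(τ₀) decides which of the two common subsets applies.
  · rcases le_abs.1 ht with h | h
    · exact g₄ t h δ hδ
    · exact g₅ t (by simpa using h) δ hδ
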